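/- A polygon is a self-avoiding polygon on the square lattice $\mathbb Z^2$, up to translation; it is rooted in the bottom-left corner if it passes through the bottom-left corner of its minimum bounding rectangle. A rooted polygon is $2$-unimodal if its perimeter exceeds the perimeter of its minimum bounding rectangle by $4$, and $2$-staircase if moreover it passes through the top-right corner of the rectangle. Its left arc is the clockwise boundary walk from the bottom-left corner to the last vertex on the top side of the rectangle. It has two distinct vertical indents on the left arc if the left arc contains exactly two down steps and at least one up step between them; the height of an indent is the height of the lower end of its down step. The generating function of a class of polygons is $\sum_{m,n} p_{2m,2n}x^my^n$, where $p_{2m,2n}$ is the number of polygons in the class with $2m$ horizontal and $2n$ vertical steps. Put $\Delta = 1-2x-2y-2xy+x^2+y^2$, $Z = 1/\sqrt\Delta$, $SP = (1-x-y-\sqrt\Delta)/2$ (where $\sqrt\Delta$ has constant term $1$), $u = x+SP$ and $\mathcal I = u^2/(1-u)^2$. **Proposition.** Let $Q = SP/y$ (resp. $Q = xZ$). The generating function of the $2$-staircase (resp. $2$-unimodal) polygons rooted in the bottom-left corner with two distinct vertical indents on the left arc, at different heights, is $$\tfrac12\, y^5\,\partial_y\bigl(\mathcal I^2\,\partial_y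 Q\bigr).$$ If the two indents are also allowed to be at the same height, the generating function is $$\tfrac12\, y^3\,\partial_y\bigl((y\,\mathcal I)^2\,\partial_y Q\bigr).$$ -/

import Mathlib

noncomputable section

namespace AlmostConvex

/-! ### Self-avoiding polygons rooted at the bottom-left corner of their bounding rectangle -/

/-- Unit steps on the square lattice: up, right, down, left. -/
inductive Step
  | U | R | D | L
  deriving DecidableEq

/-- The displacement of a step. -/
def Step.vec : Step → ℤ × ℤ
  | .U => (0, 1)
  | .R => (1, 0)
  | .D => (0, -1)
  | .L => (-1, 0)

/-- The vertex reached after the first `i` steps of the walk `w` that starts at the origin. -/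
def pos (w : List Step) (i : ℕ) : ℤ × ℤ := ((w.take i).map Step.vec).sum

/-- Self-avoiding polygons whose minimum bounding rectangle has its bottom-left corner at the origin
and which pass through that corner. A polygon is encoded by its clockwise boundary walk from the
origin: the origin has exactly the two neighbours `(0, 1)` and `(1, 0)` on the polygon, and the
clockwise walk is the one whose first step is up. So polygons and words correspond bijectively. -/
structure IsRootedPolygon (w : List Step) : Prop where
  four_le : 4 ≤ w.length
  closed : pos w w.length = 0
  simple : ∀ i j, i < j → j < w.length → pos w i ≠ pos w j
  nonneg : ∀ i ≤ w.length, 0 ≤ (pos w i).1 ∧ 0 ≤ (pos w i).2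
  start : w.head? = some Step.U

/-- Width of the minimum bounding rectangle (for a rooted polygon). -/
def width (w : List Step) : ℕ := (Finset.range (w.length + 1)).sup fun i => (pos w i).1.toNat

/-- Height of the minimum bounding rectangle (for a rooted polygon). -/
def height (w : List Step) : ℕ := (Finset.range (w.length + 1)).sup fun i => (pos w i).2.toNat

/-- Number of horizontal steps. -/
def hsteps (w : List Step) : ℕ := w.count Step.R + w.count Step.L

/-- Number of vertical steps. -/
def vsteps (w : List Step) : ℕ := w.count Step.U + w.count Step.D

/-- `m`-unimodal polygons rooted in the bottom-left corner: they visit the bottom-left corner of the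
minimum bounding rectangle, and their perimeter exceeds that of the rectangle by `2 * m`. -/
def IsUnimodal (m : ℕ) (w : List Step) : Prop :=
  IsRootedPolygon w ∧ w.length = 2 * (width w + height w) + 2 * m

/-- `m`-staircase polygons rooted in the bottom-left corner: they also visit the top-right corner of
the minimum bounding rectangle. -/
def IsStaircase (m : ℕ) (w : List Step) : Prop :=
  IsUnimodal m w ∧ ∃ i ≤ w.length, pos w i = ((width w : ℤ), (height w : ℤ))

/-- The left arc of a rooted polygon: the clockwise walk from the bottom-left corner to the last
vertex on the top side of the minimum bounding rectangle. -/
def leftArc (w : List Step) : List Step :=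
  w.take (((Finset.range (w.length + 1)).filter fun i => (pos w i).2 = (height w : ℤ)).sup id)

/-- The left arc has exactly two vertical indents, both one deep, and their bases (the lower ends of
the two down steps) are at the heights `k₁` (first indent) and `k₂` (second indent). The vertical
steps of the left arc are `a` times up, down, `b` times up, down, `c` times up; the indents are two
distinct ones (rather than a single indent that is two deep) because `1 ≤ b`. -/
def TwoVerticalIndents (w : List Step) (k₁ k₂ : ℕ) : Prop :=
  ∃ a b c : ℕ, 1 ≤ b ∧
    (leftArc w).filter (fun s => s = Step.U ∨ s = Step.D) =
      List.replicate a Step.U ++ [Step.D] ++ List.replicate b Step.U ++ [Step.D] ++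
        List.replicate c Step.U ∧
    k₁ + 1 = a ∧ k₂ + 2 = a + b

/-! ### Generating functions -/

/-- The variable `x`. -/
def x : MvPowerSeries (Fin 2) ℚ := MvPowerSeries.X 0

/-- The variable `y`. -/
def y : MvPowerSeries (Fin 2) ℚ := MvPowerSeries.X 1

/-- The (anisotropic) half-perimeter generating function of a class of polygons: the coefficient of
`x ^ m * y ^ n` is the number of members with `2 * m` horizontal and `2 * n` vertical steps. -/
def genFun (S : Set (List Step)) : MvPowerSeries (Fin 2) ℚ :=
  fun n => ({w ∈ S | hsteps w = 2 * n 0 ∧ vsteps w = 2 * n 1}.ncard : ℚ)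

/-- The sets counted by `genFun` are finite. -/
theorem finite_steps (S : Set (List Step)) (m n : ℕ) :
    {w ∈ S | hsteps w = m ∧ vsteps w = n}.Finite := by
  have : Finite Step := Finite.of_surjective
    (fun i : Fin 4 => match i with | 0 => Step.U | 1 => Step.R | 2 => Step.D | 3 => Step.L) (by
      rintro (_ | _ | _ | _)
      exacts [⟨0, rfl⟩, ⟨1, rfl⟩, ⟨2, rfl⟩, ⟨3, rfl⟩])
  refine (List.finite_length_eq Step (m + n)).subset ?_
  rintro w ⟨-, h1, h2⟩
  have key : ∀ l : List Step, l.length = hsteps l + vsteps l := by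
    intro l
    induction l with
    | nil => rfl
    | cons s l ih =>
      simp only [hsteps, vsteps] at *
      cases s <;> simp <;> omega
  change w.length = m + n
  rw [key, h1, h2]

/-- The discriminant `1 - 2x - 2y - 2xy + x² + y²`. -/
def Δ : MvPowerSeries (Fin 2) ℚ := 1 - 2 * x - 2 * y - 2 * x * y + x ^ 2 + y ^ 2

/-- The square root of `Δ` with constant term `1`: the binomial series `(1 + t) ^ (1 / 2)` at
`t = Δ - 1`. -/
def sqrtΔ : MvPowerSeries (Fin 2) ℚ :=
  (PowerSeries.binomialSeries ℚ (1 / 2 : ℚ)).subst (Δ - 1)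

/-- The generating function `Z = 1 / √Δ` of staircase festoons. -/
def Z : MvPowerSeries (Fin 2) ℚ := sqrtΔ⁻¹

/-- The generating function `(1 - x - y - √Δ) / 2` of staircase polygons. -/
def SP : MvPowerSeries (Fin 2) ℚ := (1 / 2 : ℚ) • (1 - x - y - sqrtΔ)

/-- The series `u = x + SP`. -/
def u : MvPowerSeries (Fin 2) ℚ := x + SP

/-- The generating function `u² / (1 - u)²` of indent factors. -/
def I : MvPowerSeries (Fin 2) ℚ := u ^ 2 * ((1 - u)⁻¹) ^ 2

/-- The partial derivative in `y`. -/
def dy (f : MvPowerSeries (Fin 2) ℚ) : MvPowerSeries (Fin 2) ℚ := MvPowerSeries.pderiv ℚ 1 f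

/-- The quotient `f / y` of a series `f` that is divisible by `y`. -/
def divY (f : MvPowerSeries (Fin 2) ℚ) : MvPowerSeries (Fin 2) ℚ :=
  fun n => MvPowerSeries.coeff (n + Finsupp.single 1 1) f

theorem divY_y_mul (g : MvPowerSeries (Fin 2) ℚ) : divY (y * g) = g := by
  ext n
  change MvPowerSeries.coeff (n + Finsupp.single 1 1) (y * g) = _
  rw [y, mul_comm, MvPowerSeries.X, MvPowerSeries.coeff_add_mul_monomial, mul_one]

theorem hasSubst_Δ : PowerSeries.HasSubst (Δ - 1) := by
  apply PowerSeries.HasSubst.of_constantCoeff_zero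
  simp [Δ, x, y]

theorem sqrtΔ_sq : sqrtΔ ^ 2 = Δ := by
  have h : (PowerSeries.binomialSeries ℚ (1 / 2 : ℚ)) ^ 2 = 1 + PowerSeries.X := by
    rw [pow_two, ← PowerSeries.binomialSeries_add]
    have := PowerSeries.binomialSeries_nat (R := ℚ) (A := ℚ) 1
    norm_num at this ⊢
    exact this
  rw [sqrtΔ, ← PowerSeries.subst_pow hasSubst_Δ, h, PowerSeries.subst_add hasSubst_Δ,
    PowerSeries.subst_X hasSubst_Δ, ← PowerSeries.coe_substAlgHom hasSubst_Δ, map_one]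
  ring

theorem constantCoeff_sqrtΔ : MvPowerSeries.constantCoeff sqrtΔ = 1 := by
  have h0 := PowerSeries.constantCoeff_subst_eq_zero (a := Δ - 1) (by simp [Δ, x, y])
    (PowerSeries.binomialSeries ℚ (1 / 2 : ℚ) - 1) (by simp)
  rw [PowerSeries.subst_sub hasSubst_Δ, map_sub, ← PowerSeries.coe_substAlgHom hasSubst_Δ,
    map_one, map_one, PowerSeries.coe_substAlgHom hasSubst_Δ, sub_eq_zero] at h0
  exact h0

/-- `SP` is divisible by `y`. -/
theorem y_mul_divY_SP : y * divY SP = SP := by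
  have hu : MvPowerSeries.constantCoeff (1 - u) ≠ 0 := by
    simp [u, SP, x, y, constantCoeff_sqrtΔ]
  have h2 : (2 : MvPowerSeries (Fin 2) ℚ) * SP = 1 - x - y - sqrtΔ := by
    rw [two_mul, SP, ← add_smul]
    norm_num
  have hq : (2 : MvPowerSeries (Fin 2) ℚ) * 2 * (SP * (1 - u)) = 2 * 2 * (y * u) := by
    have hs : sqrtΔ = 1 - x - y - 2 * SP := by rw [h2]; ring
    have h := sqrtΔ_sq
    rw [hs, Δ] at h
    rw [u]
    linear_combination -h
  have h20 : (2 : MvPowerSeries (Fin 2) ℚ) ≠ 0 := by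
    intro h
    have := congrArg MvPowerSeries.constantCoeff h
    rw [map_ofNat, map_zero] at this
    norm_num at this
  have hq2 : SP * (1 - u) = y * u := mul_left_cancel₀ (mul_ne_zero h20 h20) hq
  have h3 : SP = y * (u * (1 - u)⁻¹) := by
    rw [← mul_assoc, ← hq2, mul_assoc, MvPowerSeries.mul_inv_cancel _ hu, mul_one]
  rw [h3, divY_y_mul]

end AlmostConvex

end

/-! Cut a polygon at its bottom-left corner and at the end of its left arc, and let both arcs grow
from the corner, row by row, with the horizontal gap `d` between their free ends as a catalytic
variable. The generating functions of such pairs of arcs satisfy linear recurrences in `d`, whose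
solution is determined `y`-adically; without indents it is a constant times `y u ^ d / (1 - u)`.
Building an indent at the top of the left arc sums twice over larger gaps, which multiplies these
powers of `u` by `I`. Since `y` marks the rows, `∂_y` of a solution solves the recurrences with a
source in every row: this is how the next indent enters. For two indents at different heights the
source is `I ∂_y (I f)`, which is half of `∂_y (I² f) + I² ∂_y f`, hence the factor `1 / 2`. -/

noncomputable section

namespace AlmostConvex

/-! ### Recurrences with a catalytic gap -/

/-- Formal power series in `x` and `y`. -/
abbrev Ser := MvPowerSeries (Fin 2) ℚ

theorem y_ne_zero : y ≠ 0 := nonZeroDivisors.ne_zero MvPowerSeries.X_mem_nonzeroDivisors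

theorem y_pow_dvd_of_tail {n : ℕ} {V : ℕ → Ser} (h : ∀ d, y ^ n ∣ V (d + 1) - V (d + 2))
    (tail : ∀ d, x ^ d ∣ V d) (d : ℕ) : y ^ n ∣ V (d + 1) := by
  simp only [x, y, MvPowerSeries.X_pow_dvd_iff, map_sub] at *
  intro m hm
  have coeff_shift (k : ℕ) : MvPowerSeries.coeff m (V (d + 1)) =
      MvPowerSeries.coeff m (V (d + k + 1)) := by
    induction k with
    | zero => rfl
    | succ k ih => exact ih.trans (sub_eq_zero.1 (h (d + k) m hm))
  rw [coeff_shift (m 0)]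
  exact tail (d + m 0 + 1) m (by omega)

theorem eq_zero_of_forall_y_pow_dvd {f : Ser} (h : ∀ n, y ^ n ∣ f) : f = 0 := by
  ext m
  simp only [y, MvPowerSeries.X_pow_dvd_iff] at h
  exact h (m 1 + 1) m (by omega)

theorem eq_of_tail {p V V' : ℕ → Ser} (hV : ∀ d, V (d + 1) = p (d + 1) + V (d + 2))
    (hV' : ∀ d, V' (d + 1) = p (d + 1) + V' (d + 2)) (tail : ∀ d, x ^ d ∣ V d)
    (tail' : ∀ d, x ^ d ∣ V' d) (d : ℕ) : V (d + 1) = V' (d + 1) := by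
  refine sub_eq_zero.1 (eq_zero_of_forall_y_pow_dvd fun n => ?_)
  refine y_pow_dvd_of_tail (V := V - V') (fun d => ?_) (fun d => dvd_sub (tail d) (tail' d)) d
  rw [Pi.sub_apply, Pi.sub_apply, hV, hV', add_sub_add_left_eq_sub, sub_self]
  exact dvd_zero _

/-- Whether, read from the bottom, the right arc has only moved to the right (`inc`) or has already
turned back to the left (`dec`). -/
inductive Stage
  | inc
  | dec

/-- The recurrences in the gap `d` for pairs of partial arcs: `A` counts the pairs whose last
vertical step on the left is up and `h` those where it is down, both with a right arc that has just
gone up, while `B` counts the pairs in the middle of a horizontal run of the right arc. The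
constant `c` is the initial value of `B`. -/
structure RowSystem (c : Ser) (h A B : Stage → ℕ → Ser) : Prop where
  ready : ∀ σ d, A σ (d + 1) = y * B σ (d + 1) + A σ (d + 2)
  init : B .inc 0 = c
  inc : ∀ d, B .inc (d + 1) = A .inc (d + 1) + h .inc (d + 1) + x * B .inc d
  dec : ∀ d, B .dec (d + 1) =
    A .dec (d + 1) + h .dec (d + 1) + (A .inc (d + 2) + h .inc (d + 2)) + B .dec (d + 2)
  tail : ∀ σ d, x ^ d ∣ A σ d
  tail_dec : ∀ d, x ^ d ∣ B .dec d

namespace RowSystem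

variable {c : Ser} {h h' A A' B B' : Stage → ℕ → Ser}

theorem sub (H : RowSystem c h A B) (H' : RowSystem c h' A' B')
    (hh : ∀ σ d, h σ (d + 1) = h' σ (d + 1)) : RowSystem 0 0 (A - A') (B - B') where
  ready σ d := by simp only [Pi.sub_apply, H.ready σ d, H'.ready σ d]; ring
  init := by simp only [Pi.sub_apply, H.init, H'.init, sub_self]
  inc d := by simp only [Pi.sub_apply, Pi.zero_apply, H.inc, H'.inc, hh]; ring
  dec d := by simp only [Pi.sub_apply, Pi.zero_apply, H.dec d, H'.dec d, hh]; ring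
  tail σ d := dvd_sub (H.tail σ d) (H'.tail σ d)
  tail_dec d := dvd_sub (H.tail_dec d) (H'.tail_dec d)

theorem y_pow_dvd (H : RowSystem 0 0 A B) {n : ℕ} (hA : ∀ σ d, y ^ n ∣ A σ (d + 1)) :
    ∀ σ d, y ^ n ∣ B σ (d + 1)
  | .inc, d => by
    have all (d : ℕ) : y ^ n ∣ B .inc d := by
      induction d with
      | zero => rw [H.init]; exact dvd_zero _
      | succ d ih =>
        rw [H.inc]
        exact dvd_add (dvd_add (hA _ _) (dvd_zero _)) (ih.mul_left x)
    exact all _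
  | .dec, d => by
    refine y_pow_dvd_of_tail (fun d => ?_) H.tail_dec d
    rw [H.dec, add_sub_cancel_right]
    exact dvd_add (dvd_add (hA _ _) (dvd_zero _)) (dvd_add (hA _ _) (dvd_zero _))

theorem eq_zero (H : RowSystem 0 0 A B) (σ : Stage) (d : ℕ) : A σ (d + 1) = 0 := by
  have key (n : ℕ) : ∀ σ d, y ^ n ∣ A σ (d + 1) := by
    induction n with
    | zero => simp
    | succ n ih =>
      refine fun σ => y_pow_dvd_of_tail (fun d => ?_) (H.tail σ)
      rw [H.ready, add_sub_cancel_right, pow_succ']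
      exact mul_dvd_mul_left y (H.y_pow_dvd ih σ d)
  exact eq_zero_of_forall_y_pow_dvd fun n => key n σ d

theorem unique (H : RowSystem c h A B) (H' : RowSystem c h' A' B')
    (hh : ∀ σ d, h σ (d + 1) = h' σ (d + 1)) (σ : Stage) (d : ℕ) : A σ (d + 1) = A' σ (d + 1) :=
  sub_eq_zero.1 ((H.sub H' hh).eq_zero σ d)

theorem smul (H : RowSystem c h A B) (F : Ser) : RowSystem (F * c) (fun σ d => F * h σ d)
    (fun σ d => F * A σ d) (fun σ d => F * B σ d) where
  ready σ d := by simp only [H.ready σ d]; ring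
  init := by simp only [H.init]
  inc d := by simp only [H.inc]; ring
  dec d := by simp only [H.dec d]; ring
  tail σ d := (H.tail σ d).mul_left F
  tail_dec d := (H.tail_dec d).mul_left F

end RowSystem

/-! ### Differentiation in `y` -/

theorem dy_add (f g : Ser) : dy (f + g) = dy f + dy g := map_add _ _ _

theorem dy_mul (f g : Ser) : dy (f * g) = f * dy g + g * dy f := by
  simp [dy, Derivation.leibniz]

theorem dy_zero : dy 0 = 0 := map_zero _

theorem dy_x_mul (f : Ser) : dy (x * f) = x * dy f := by
  simp [dy, x, Derivation.leibniz]

theorem dy_y_mul (f : Ser) : dy (y * f) = f + y * dy f := by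
  rw [dy_mul]
  simp [dy, y, add_comm]

theorem x_pow_dvd_dy {f : Ser} {d : ℕ} (h : x ^ d ∣ f) : x ^ d ∣ dy f := by
  obtain ⟨g, rfl⟩ := h
  induction d generalizing g with
  | zero => simp
  | succ d ih =>
    rw [pow_succ', mul_assoc, dy_x_mul]
    exact mul_dvd_mul_left x (ih g)

theorem half_smul_add_half_smul (f : Ser) : (1 / 2 : ℚ) • f + (1 / 2 : ℚ) • f = f := by
  rw [← add_smul]
  norm_num

theorem dy_half_smul (f : Ser) : dy ((1 / 2 : ℚ) • f) = (1 / 2 : ℚ) • dy f :=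
  (MvPowerSeries.pderiv ℚ 1).map_smul _ _

theorem RowSystem.dy {c : Ser} {h A B : Stage → ℕ → Ser}
    (H : RowSystem c h (fun σ d => y * A σ d) B) (hA : ∀ σ d, x ^ d ∣ A σ d) :
    RowSystem (dy c) (fun σ d => dy (h σ d) + A σ d) (fun σ d => y * dy (A σ d))
      (fun σ d => dy (B σ d)) where
  ready σ d := by
    have cancel : A σ (d + 1) = B σ (d + 1) + A σ (d + 2) :=
      mul_left_cancel₀ y_ne_zero ((H.ready σ d).trans (mul_add _ _ _).symm)
    rw [cancel, dy_add, mul_add]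
  init := by rw [H.init]
  inc d := by
    rw [H.inc]
    simp only [dy_add, dy_x_mul, dy_y_mul]
    ring
  dec d := by
    rw [H.dec]
    simp only [dy_add, dy_y_mul]
    ring
  tail σ d := (x_pow_dvd_dy (hA σ d)).mul_left y
  tail_dec d := x_pow_dvd_dy (H.tail_dec d)

/-! ### The algebraic series -/

theorem constantCoeff_u : MvPowerSeries.constantCoeff u = 0 := by
  simp [u, SP, x, y, constantCoeff_sqrtΔ]

theorem sqrtΔ_eq : sqrtΔ = 1 + x - y - 2 * u := by
  have two_mul_SP : (2 : Ser) * SP = 1 - x - y - sqrtΔ := by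
    rw [two_mul, SP, half_smul_add_half_smul]
  rw [u]
  linear_combination two_mul_SP

theorem u_quadratic : u ^ 2 - (1 + x - y) * u + x = 0 := by
  have four_ne_zero : algebraMap ℚ Ser 4 ≠ 0 :=
    (map_ne_zero_iff _ (FaithfulSMul.algebraMap_injective ℚ Ser)).2 (by norm_num)
  have h := sqrtΔ_sq
  rw [sqrtΔ_eq, Δ] at h
  rw [map_ofNat] at four_ne_zero
  refine (mul_eq_zero.1 (?_ : (4 : Ser) * _ = 0)).resolve_left four_ne_zero
  linear_combination h

/-- The geometric series `1 / (1 - u)`. -/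
def geomU : Ser := (1 - u)⁻¹

theorem geomU_mul : geomU * (1 - u) = 1 :=
  MvPowerSeries.inv_mul_cancel _ (by simp [constantCoeff_u])

/-- The factor `y u / ((1 - u)² - y)` by which the solution of the recurrences in the stage `dec`
differs from the one in the stage `inc`. -/
def decRatio : Ser := y * u * ((1 - u) ^ 2 - y)⁻¹

theorem decRatio_mul : decRatio * ((1 - u) ^ 2 - y) = y * u := by
  rw [decRatio, mul_assoc, MvPowerSeries.inv_mul_cancel _ (by simp [constantCoeff_u, y]), mul_one]

theorem u_sub_x : u - x = y * u * geomU := by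
  linear_combination (-geomU) * u_quadratic - (u - x) * geomU_mul

theorem decRatio_mul_one_sub_u :
    decRatio * (1 - u) = y * decRatio * geomU + y * u * geomU := by
  linear_combination geomU * decRatio_mul - decRatio * (1 - u) * geomU_mul

theorem x_dvd_u : x ∣ u := by
  refine ⟨(1 + x - y - u)⁻¹, ?_⟩
  have h : (1 + x - y - u) * (1 + x - y - u)⁻¹ = 1 :=
    MvPowerSeries.mul_inv_cancel _ (by simp [constantCoeff_u, x, y])
  linear_combination (-u) * h - (1 + x - y - u)⁻¹ * u_quadratic

theorem one_sub_u_mul_sqrtΔ : (1 - u) * sqrtΔ = (1 - u) ^ 2 - y := by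
  rw [sqrtΔ_eq]
  linear_combination u_quadratic

/-- The factor of a stage in the solution of the recurrences. -/
def ratio : Stage → Ser
  | .inc => 1
  | .dec => decRatio

/-- The family `κ u ^ d / (1 - u) ^ k`, where `κ` is the factor of the stage `σ`. -/
def expo (k : ℕ) (σ : Stage) (d : ℕ) : Ser := ratio σ * u ^ d * geomU ^ k

theorem x_pow_dvd_expo (k : ℕ) (σ : Stage) (d : ℕ) : x ^ d ∣ expo k σ d :=
  ((pow_dvd_pow_of_dvd x_dvd_u d).mul_left _).mul_right _

theorem I_mul_expo (k : ℕ) (σ : Stage) (d : ℕ) : I * expo k σ d = expo (k + 2) σ (d + 2) := by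
  simp only [expo, I, geomU]; ring

theorem expo_inc_one : expo 1 .inc 1 = divY SP := by
  have h : SP = y * expo 1 .inc 1 := by
    have := u_sub_x
    simp only [expo, ratio]
    rw [u] at this ⊢
    linear_combination this
  rw [h, divY_y_mul]

theorem expo_inc_one_add_expo_dec_one : expo 1 .inc 1 + expo 1 .dec 1 = x * Z := by
  have one_sub_u_ne_zero : 1 - u ≠ 0 := right_ne_zero_of_mul_eq_one geomU_mul
  rw [Z, MvPowerSeries.eq_mul_inv_iff_mul_eq (by simp [constantCoeff_sqrtΔ])]
  refine mul_left_cancel₀ one_sub_u_ne_zero ?_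
  simp only [expo, ratio]
  linear_combination (u * geomU + decRatio * u * geomU) * one_sub_u_mul_sqrtΔ +
    u * geomU * decRatio_mul + (u * (1 - u - y)) * geomU_mul - u_quadratic

/-- A family of series in which each member is the sequence of tail sums of the previous one:
`e (k + 1) d = ∑ j ≥ d, e k j`. -/
structure IsTailSum (e : ℕ → ℕ → Ser) : Prop where
  succ : ∀ k d, e (k + 1) d = e k d + e (k + 1) (d + 1)
  tail : ∀ k d, x ^ d ∣ e k d

namespace IsTailSum

variable {e : ℕ → ℕ → Ser}

theorem smul (he : IsTailSum e) (F : Ser) : IsTailSum fun k d => F * e k d where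
  succ k d := by rw [he.succ, mul_add]
  tail k d := (he.tail k d).mul_left F

theorem dy (he : IsTailSum e) : IsTailSum fun k d => dy (e k d) where
  succ k d := by rw [he.succ, dy_add]
  tail k d := x_pow_dvd_dy (he.tail k d)

theorem expo (σ : Stage) (k n : ℕ) : IsTailSum fun i d => expo (k + i) σ (d + n) where
  succ i d := by
    simp only [AlmostConvex.expo]
    linear_combination ratio σ * u ^ (d + n) * geomU ^ (k + i) * geomU_mul
  tail i d := (pow_dvd_pow x (Nat.le_add_right d n)).trans (x_pow_dvd_expo _ _ _)

theorem indent (he : IsTailSum e) {E U D : ℕ → Ser} (hE : ∀ d, E (d + 1) = e 0 (d + 1))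
    (hU : ∀ d, U (d + 1) = y * E (d + 2) + U (d + 2)) (hD : ∀ d, D (d + 1) = U (d + 2) + D (d + 2))
    (tail_U : ∀ d, x ^ d ∣ U d) (tail_D : ∀ d, x ^ d ∣ D d) (d : ℕ) :
    D (d + 1) = y * e 2 (d + 3) := by
  have tail (k n d : ℕ) : x ^ d ∣ y * e k (d + n) :=
    ((pow_dvd_pow x (Nat.le_add_right d n)).trans (he.tail k _)).mul_left y
  have U_eq : ∀ d, U (d + 1) = y * e 1 (d + 2) :=
    eq_of_tail (p := fun d => y * E (d + 1)) (V' := fun d => y * e 1 (d + 1)) hU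
      (fun d => by rw [hE, he.succ, mul_add]) tail_U (tail 1 1)
  exact eq_of_tail (p := fun d => U (d + 1)) (V' := fun d => y * e 2 (d + 2)) hD
    (fun d => by rw [U_eq, he.succ, mul_add]) tail_D (tail 2 2) d

end IsTailSum

/-! ### Solutions of the recurrences -/

theorem rowSystem_expo : RowSystem 1 0 (fun σ d => y * expo 1 σ d) (expo 0) where
  ready σ d := by
    simp only [expo]
    linear_combination y * ratio σ * u ^ (d + 1) * geomU_mul
  init := by simp [expo, ratio]
  inc d := by
    simp only [expo, ratio, Pi.zero_apply]
    linear_combination u ^ d * u_sub_x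
  dec d := by
    simp only [expo, ratio, Pi.zero_apply]
    linear_combination u ^ (d + 1) * decRatio_mul_one_sub_u
  tail σ d := (x_pow_dvd_expo _ _ _).mul_left y
  tail_dec d := x_pow_dvd_expo _ _ _

theorem rowSystem_dy_expo : RowSystem 0 (expo 1) (fun σ d => y * dy (expo 1 σ d))
    (fun σ d => dy (expo 0 σ d)) := by
  have dy_one : dy 1 = 0 := Derivation.map_one_eq_zero _
  have h := rowSystem_expo.dy (x_pow_dvd_expo 1)
  simpa only [Pi.zero_apply, dy_zero, zero_add, dy_one] using h

/-- The family `∂ (I² ∂ f) / 2`. -/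
def twice (f : Ser) : Ser := (1 / 2 : ℚ) • dy (I ^ 2 * dy f)

theorem twice_add (f g : Ser) : twice (f + g) = twice f + twice g := by
  simp only [twice, dy_add, mul_add, smul_add]

theorem dy_half_smul_add (f : Ser) : dy ((1 / 2 : ℚ) • (I ^ 2 * f)) +
    (1 / 2 : ℚ) • (I ^ 2 * dy f) = I * dy (I * f) := by
  have h : dy (I ^ 2 * f) + I ^ 2 * dy f = I * dy (I * f) + I * dy (I * f) := by
    rw [pow_two, mul_assoc, dy_mul I, dy_mul]
    ring
  rw [dy_half_smul, ← smul_add, h, smul_add, half_smul_add_half_smul]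

theorem rowSystem_twice : ∃ B, RowSystem 0 (fun σ d => I * dy (I * expo 1 σ d))
    (fun σ d => y * twice (expo 1 σ d)) B := by
  have h := rowSystem_dy_expo.smul ((1 / 2 : ℚ) • I ^ 2)
  have tail (σ : Stage) (d : ℕ) : x ^ d ∣ (1 / 2 : ℚ) • I ^ 2 * dy (expo 1 σ d) :=
    (x_pow_dvd_dy (x_pow_dvd_expo _ _ _)).mul_left _
  simp only [mul_left_comm _ y] at h
  have h' := h.dy tail
  simp only [smul_mul_assoc, dy_half_smul_add, mul_zero, dy_zero] at h'
  simp only [twice, ← dy_half_smul]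
  exact ⟨_, h'⟩

/-! ### Walks -/

/-- The displacement of a walk. -/
def endp (l : List Step) : ℤ × ℤ := (l.map Step.vec).sum

theorem endp_cons (s : Step) (l : List Step) : endp (s :: l) = s.vec + endp l := by
  simp [endp]

theorem endp_eq (l : List Step) : endp l =
    ((l.count Step.R : ℤ) - l.count Step.L, (l.count Step.U : ℤ) - l.count Step.D) := by
  induction l with
  | nil => rfl
  | cons s l ih =>
    rw [endp_cons, ih]
    cases s <;> simp [Step.vec] <;> ring

theorem length_eq_counts (l : List Step) :
    l.length = l.count Step.U + l.count Step.R + l.count Step.D + l.count Step.L := by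
  induction l with
  | nil => rfl
  | cons s l ih => cases s <;> simp <;> omega

theorem endp_fst_le_of_suffix {l l' : List Step} (hl : Step.L ∉ l) (h : l' <:+ l) :
    (endp l').1 ≤ (endp l).1 := by
  have hR := h.sublist.count_le Step.R
  have hL' : l'.count Step.L = 0 := List.count_eq_zero.2 fun hm => hl (h.mem hm)
  simp only [endp_eq, hL', List.count_eq_zero.2 hl]
  omega

theorem endp_snd_le_of_suffix {l l' : List Step} (hl : Step.U ∉ l) (h : l' <:+ l) :
    (endp l).2 ≤ (endp l').2 := by
  have hD := h.sublist.count_le Step.D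
  have hU' : l'.count Step.U = 0 := List.count_eq_zero.2 fun hm => hl (h.mem hm)
  simp only [endp_eq, hU', List.count_eq_zero.2 hl]
  omega

/-- The vertical steps of a walk. -/
def verts (l : List Step) : List Step := l.filter fun s => s = Step.U ∨ s = Step.D

theorem verts_cons (s : Step) (l : List Step) : verts (s :: l) = verts [s] ++ verts l := by
  rw [verts, ← List.singleton_append, List.filter_append, verts, verts]

/-! ### Pairs of partial arcs -/

/-- A pair of partial boundary arcs of a polygon: a prefix of the boundary word, reversed, and a
suffix of it. -/
abbrev Cfg := List Step × List Step

/-- At equal height, the first point is to the left of the second one. -/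
def LeftOf (p q : ℤ × ℤ) : Prop := p.2 = q.2 → p.1 < q.1

/-- A pair of disjoint partial arcs, both attached to the origin. The left arc has no left steps
and the right arc, read as the suffix of a clockwise walk, has no up steps and moves first to the
right and then to the left. The vertical steps of the left arc, read from its end, form a word in
`V`. The free end of the right arc is `d` to the right of that of the left arc and `e` below it.
The suffixes of the two components are the vertices of the two arcs. -/
structure Arcs (V : Set (List Step)) (d e : ℕ) (c : Cfg) : Prop where
  no_left : Step.L ∉ c.1
  no_up : Step.U ∉ c.2
  chain_left : c.1.IsChain fun s t => s.vec + t.vec ≠ 0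
  chain_right : c.2.IsChain fun s t => s.vec + t.vec ≠ 0
  start : ∀ s ∈ c.1.getLast?, s = Step.U
  ordered : c.2.Pairwise fun s t => s = Step.L → t ≠ Step.R
  word : verts c.1 ∈ V
  disjoint : ∀ Q S, Q <:+ c.1 → S <:+ c.2 → Q ≠ [] ∨ S ≠ [] → LeftOf (endp Q) (-endp S)
  gap : (endp c.1).1 + d = -(endp c.2).1
  excess : (endp c.1).2 = -(endp c.2).2 + e

/-- The stage of a right arc. -/
def stage (S : List Step) : Stage := if Step.R ∈ S then .dec else .inc

theorem stage_eq_inc {S : List Step} : stage S = .inc ↔ Step.R ∉ S := by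
  simp [stage]

theorem stage_eq_dec {S : List Step} : stage S = .dec ↔ Step.R ∈ S := by
  simp [stage]

/-- The pairs whose free ends are at equal height and whose right arc has just gone up. -/
def ready (V : Set (List Step)) (σ : Stage) (d : ℕ) : Set Cfg :=
  {c | Arcs V d 0 c ∧ stage c.2 = σ ∧ c.1.head? ≠ some Step.D ∧ c.2.head? = some Step.D}

/-- The pairs whose free ends are at equal height and whose right arc may be in a horizontal run. -/
def free (V : Set (List Step)) (σ : Stage) (d : ℕ) : Set Cfg :=
  {c | Arcs V d 0 c ∧ stage c.2 = σ ∧ c.1.head? ≠ some Step.D}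

/-- The pairs whose left arc is one unit higher than the right one and in a horizontal run, on top
of an indent. -/
def raised (V : Set (List Step)) (σ : Stage) (d : ℕ) : Set Cfg :=
  {c | Arcs V d 1 c ∧ stage c.2 = σ ∧ c.1.head? = some Step.R ∧ c.2.head? = some Step.D}

theorem leftOf_neg_endp_of_suffix {S S' : List Step} (hU : Step.U ∉ S) (hS' : S' <:+ S)
    {p : ℤ × ℤ} (hp : p.1 < -(endp S).1)
    (htop : -(endp S).2 < p.2 ∨ -(endp S).2 = p.2 ∧ S.head? = some Step.D) :
    LeftOf p (-endp S') := by
  intro heq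
  simp only [Prod.snd_neg, Prod.fst_neg] at heq ⊢
  rcases htop with hlt | ⟨htop, hD⟩
  · have := endp_snd_le_of_suffix hU hS'
    omega
  · obtain ⟨T, rfl⟩ := List.head?_eq_some_iff.1 hD
    rcases List.suffix_cons_iff.1 hS' with rfl | hT
    · exact hp
    · have := endp_snd_le_of_suffix (fun h => hU (List.mem_cons_of_mem _ h)) hT
      rw [endp_cons] at htop
      simp only [Step.vec, Prod.snd_add] at htop
      omega

namespace Arcs

variable {V : Set (List Step)} {d e : ℕ} {Q S : List Step}

theorem left_ne_nil (h : Arcs V d e (Q, S)) (hS : 0 < e ∨ S.head? = some Step.D) : Q ≠ [] := by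
  rintro rfl
  have excess : (0 : ℤ) = -(endp S).2 + e := h.excess
  have hU : S.count Step.U = 0 := List.count_eq_zero.2 h.no_up
  rw [endp_eq, hU] at excess
  rcases hS with hpos | hD
  · dsimp only at excess
    omega
  · obtain ⟨T, rfl⟩ := List.head?_eq_some_iff.1 hD
    simp only [List.count_cons_self] at excess
    omega

theorem right_ne_nil (h : Arcs V (d + 1) e (Q, S)) : S ≠ [] := by
  rintro rfl
  have gap : (endp Q).1 + (d + 1 : ℕ) = 0 := h.gap
  have hL : Q.count Step.L = 0 := List.count_eq_zero.2 h.no_left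
  rw [endp_eq, hL] at gap
  dsimp only at gap
  omega

theorem cons_left_iff {s : Step} {d' e' : ℕ} (hd : (d' : ℤ) = d + 1 + s.vec.1)
    (he : (e : ℤ) = e' + s.vec.2) (hS : 0 < e ∨ S.head? = some Step.D) :
    Arcs V (d + 1) e (s :: Q, S) ↔ s ≠ Step.L ∧ (∀ t ∈ Q.head?, s.vec + t.vec ≠ 0) ∧
      (Q = [] → s = Step.U) ∧ Arcs ((verts [s] ++ ·) ⁻¹' V) d' e' (Q, S) := by
  constructor
  · intro h
    have gap := h.gap
    have excess := h.excess
    have chain := List.isChain_cons.1 h.chain_left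
    simp only [endp_cons, Prod.fst_add, Prod.snd_add] at gap excess
    refine ⟨fun hs => h.no_left (by simp [hs]), chain.1, ?_, ?_⟩
    · rintro rfl
      exact h.start s (by simp)
    · exact {
        no_left := fun hL => h.no_left (List.mem_cons_of_mem _ hL)
        no_up := h.no_up
        chain_left := chain.2
        chain_right := h.chain_right
        start := fun t ht => h.start t (by
          change (s :: Q).getLast? = some t
          rw [List.getLast?_cons, Option.mem_def.1 ht]
          rfl)
        ordered := h.ordered
        word := by
          rw [Set.mem_preimage, ← verts_cons]
          exact h.word
        disjoint := fun Q' S' hQ' => h.disjoint Q' S' (hQ'.trans (List.suffix_cons s Q))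
        gap := by dsimp only; omega
        excess := by dsimp only; omega }
  · rintro ⟨hL, chain, hnil, h⟩
    have gap := h.gap
    have excess := h.excess
    dsimp only at gap excess
    have gap' : (endp (s :: Q)).1 + (d + 1 : ℕ) = -(endp S).1 := by
      rw [endp_cons, Prod.fst_add]; push_cast; omega
    have excess' : (endp (s :: Q)).2 = -(endp S).2 + e := by
      rw [endp_cons, Prod.snd_add]; omega
    exact {
      no_left := by simp only [List.mem_cons, not_or]; exact ⟨Ne.symm hL, h.no_left⟩
      no_up := h.no_up
      chain_left := List.isChain_cons.2 ⟨chain, h.chain_left⟩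
      chain_right := h.chain_right
      start := by
        intro t ht
        rcases Q.eq_nil_or_concat with rfl | ⟨Q', q, rfl⟩
        · obtain rfl : s = t := by simpa using ht
          exact hnil rfl
        · exact h.start t (by simpa [List.getLast?_cons] using ht)
      ordered := h.ordered
      word := by rw [verts_cons]; exact h.word
      disjoint := by
        intro Q' S' hQ' hS' hne
        rcases List.suffix_cons_iff.1 hQ' with rfl | hQ'
        · refine leftOf_neg_endp_of_suffix (S := S) h.no_up hS' (by omega) ?_
          rcases hS with hpos | hD
          · exact .inl (by omega)
          · rcases e.eq_zero_or_pos with rfl | hpos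
            · exact .inr ⟨by simp [excess'], hD⟩
            · exact .inl (by omega)
        · exact h.disjoint Q' S' hQ' hS' hne
      gap := gap'
      excess := excess' }

theorem cons_right_iff {t : Step} {d' e' : ℕ} (hd : (d' : ℤ) = d + 1 + t.vec.1)
    (he : (e : ℤ) = e' + t.vec.2) :
    Arcs V (d + 1) e (Q, t :: S) ↔ t ≠ Step.U ∧ (∀ s ∈ S.head?, t.vec + s.vec ≠ 0) ∧
      (t = Step.L → Step.R ∉ S) ∧ Arcs V d' e' (Q, S) := by
  constructor
  · intro h
    have gap := h.gap
    have excess := h.excess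
    have chain := List.isChain_cons.1 h.chain_right
    have ordered := List.pairwise_cons.1 h.ordered
    simp only [endp_cons, Prod.fst_add, Prod.snd_add] at gap excess
    refine ⟨fun ht => h.no_up (by simp [ht]), chain.1, fun ht hR => ordered.1 _ hR ht rfl, ?_⟩
    exact {
      no_left := h.no_left
      no_up := fun hU => h.no_up (List.mem_cons_of_mem _ hU)
      chain_left := h.chain_left
      chain_right := chain.2
      start := h.start
      ordered := ordered.2
      word := h.word
      disjoint := fun Q' S' hQ' hS' => h.disjoint Q' S' hQ' (hS'.trans (List.suffix_cons t S))
      gap := by dsimp only; omega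
      excess := by dsimp only; omega }
  · rintro ⟨hU, chain, hR, h⟩
    have gap := h.gap
    have excess := h.excess
    dsimp only at gap excess
    have gap' : (endp Q).1 + (d + 1 : ℕ) = -(endp (t :: S)).1 := by
      rw [endp_cons, Prod.fst_add]; push_cast; omega
    exact {
      no_left := h.no_left
      no_up := by simp only [List.mem_cons, not_or]; exact ⟨Ne.symm hU, h.no_up⟩
      chain_left := h.chain_left
      chain_right := List.isChain_cons.2 ⟨chain, h.chain_right⟩
      start := h.start
      ordered := List.pairwise_cons.2 ⟨fun s hs ht hsR => hR ht (hsR ▸ hs), h.ordered⟩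
      word := h.word
      disjoint := by
        intro Q' S' hQ' hS' hne
        rcases List.suffix_cons_iff.1 hS' with rfl | hS'
        · have : (endp Q').1 ≤ (endp Q).1 := endp_fst_le_of_suffix h.no_left hQ'
          intro _
          rw [Prod.fst_neg]
          omega
        · exact h.disjoint Q' S' hQ' hS' hne
      gap := gap'
      excess := by
        dsimp only
        rw [endp_cons, Prod.snd_add]
        omega }

theorem cons_R_left_iff (hS : 0 < e ∨ S.head? = some Step.D) :
    Arcs V (d + 1) e (Step.R :: Q, S) ↔ Arcs V (d + 2) e (Q, S) := by
  rw [cons_left_iff (d' := d + 2) (e' := e) (by simp [Step.vec]; ring) (by simp [Step.vec]) hS]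
  refine ⟨fun h => h.2.2.2, fun h => ⟨by simp, ?_, ?_, h⟩⟩
  · intro t ht
    have : t ≠ Step.L := fun hL => h.no_left (hL ▸ List.mem_of_mem_head? ht)
    cases t <;> simp_all [Step.vec]
  · rintro rfl
    exact absurd rfl (h.left_ne_nil hS)

theorem cons_D_left_iff (hS : S.head? = some Step.D) :
    Arcs (List.cons Step.D '' V) (d + 1) 0 (Step.D :: Q, S) ↔
      Q.head? ≠ some Step.U ∧ Arcs V (d + 1) 1 (Q, S) := by
  rw [cons_left_iff (d' := d + 1) (e' := 1) (by simp [Step.vec]) (by simp [Step.vec]) (.inr hS)]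
  change _ ∧ _ ∧ _ ∧ Arcs (List.cons Step.D ⁻¹' _) _ _ _ ↔ _
  rw [Set.preimage_image_eq _ List.cons_injective]
  refine ⟨fun h => ⟨fun hU => h.2.1 _ hU rfl, h.2.2.2⟩, fun h => ⟨by simp, ?_, ?_, h.2⟩⟩
  · rintro (_ | _ | _ | _) ht
    · exact absurd ht h.1
    all_goals decide
  · rintro rfl
    exact absurd rfl (h.2.left_ne_nil (.inr hS))

theorem cons_U_left_iff : Arcs (List.cons Step.U '' V) (d + 1) (e + 1) (Step.U :: Q, S) ↔
    Q.head? ≠ some Step.D ∧ Arcs V (d + 1) e (Q, S) := by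
  rw [cons_left_iff (d' := d + 1) (e' := e) (by simp [Step.vec]) (by simp [Step.vec])
    (.inl e.succ_pos)]
  change _ ∧ _ ∧ _ ∧ Arcs (List.cons Step.U ⁻¹' _) _ _ _ ↔ _
  rw [Set.preimage_image_eq _ List.cons_injective]
  refine ⟨fun h => ⟨fun hD => h.2.1 _ hD rfl, h.2.2.2⟩, fun h => ⟨by simp, ?_, by simp, h.2⟩⟩
  rintro (_ | _ | _ | _) ht
  case D => exact absurd ht h.1
  all_goals decide

theorem cons_D_right_iff : Arcs V (d + 1) e (Q, Step.D :: S) ↔ Arcs V (d + 1) (e + 1) (Q, S) := by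
  rw [cons_right_iff (d' := d + 1) (e' := e + 1) (by simp [Step.vec]) (by simp [Step.vec])]
  refine ⟨fun h => h.2.2.2, fun h => ⟨by simp, fun s hs => ?_, by simp, h⟩⟩
  have : s ≠ Step.U := fun hU => h.no_up (hU ▸ List.mem_of_mem_head? hs)
  cases s <;> simp_all [Step.vec]

theorem cons_L_right_iff :
    Arcs V (d + 1) e (Q, Step.L :: S) ↔ Step.R ∉ S ∧ Arcs V d e (Q, S) := by
  rw [cons_right_iff (d' := d) (e' := e) (by simp [Step.vec]) (by simp [Step.vec])]
  refine ⟨fun h => ⟨h.2.2.1 rfl, h.2.2.2⟩, fun h => ⟨by simp, fun s hs => ?_, fun _ => h.1, h.2⟩⟩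
  have : s ≠ Step.R := fun hR => h.1 (hR ▸ List.mem_of_mem_head? hs)
  cases s <;> simp_all [Step.vec]

theorem cons_R_right_iff :
    Arcs V (d + 1) e (Q, Step.R :: S) ↔ S.head? ≠ some Step.L ∧ Arcs V (d + 2) e (Q, S) := by
  rw [cons_right_iff (d' := d + 2) (e' := e) (by simp [Step.vec]; ring) (by simp [Step.vec])]
  refine ⟨fun h => ⟨fun hL => h.2.1 _ hL rfl, h.2.2.2⟩, fun h => ⟨by simp, ?_, by simp, h.2⟩⟩
  rintro (_ | _ | _ | _) ht
  case L => exact absurd ht h.1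
  all_goals decide

end Arcs

/-! ### Taking off the last steps -/

/-- Put a step, or several steps, on each of the two arcs. -/
def push (p q : List Step) (c : Cfg) : Cfg := (p ++ c.1, q ++ c.2)

section Decompositions

variable {V T : Set (List Step)} {σ : Stage} {d : ℕ}

theorem head?_ne_of_verts_mem {s t : Step} {Q : List Step} (hs : verts [s] = [s]) (hst : s ≠ t)
    (hQ : verts Q ∈ List.cons t '' V) : Q.head? ≠ some s := by
  intro h
  obtain ⟨Q', rfl⟩ := List.head?_eq_some_iff.1 h
  obtain ⟨v, -, hv⟩ := hQ
  rw [verts_cons, hs] at hv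
  exact hst (List.cons.inj hv).1.symm

theorem ready_cons_U : ready (List.cons Step.U '' T) σ (d + 1) =
    push [Step.U] [Step.D] '' free T σ (d + 1) ∪
      push [Step.R] [] '' ready (List.cons Step.U '' T) σ (d + 2) := by
  ext ⟨Q, S⟩
  constructor
  · rintro ⟨h, hσ, hQ, hS⟩
    obtain ⟨S, rfl⟩ := List.head?_eq_some_iff.1 hS
    rcases Q with _ | ⟨_ | _ | _ | _, Q⟩
    · exact absurd rfl (h.left_ne_nil (.inr hS))
    · have hU := Arcs.cons_U_left_iff.1 (Arcs.cons_D_right_iff.1 h)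
      exact .inl ⟨(Q, S), ⟨hU.2, by simpa [stage] using hσ, hU.1⟩, rfl⟩
    · have hR := (Arcs.cons_R_left_iff (.inr hS)).1 h
      exact .inr ⟨(Q, Step.D :: S),
        ⟨hR, hσ, head?_ne_of_verts_mem rfl (by decide) hR.word, hS⟩, rfl⟩
    · exact absurd rfl hQ
    · exact absurd List.mem_cons_self h.no_left
  · rintro (⟨⟨Q, S⟩, ⟨h, hσ, hQ⟩, heq⟩ | ⟨⟨Q, S⟩, ⟨h, hσ, -, hS⟩, heq⟩) <;>
      obtain ⟨rfl, rfl⟩ := Prod.mk.inj heq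
    · exact ⟨Arcs.cons_D_right_iff.2 (Arcs.cons_U_left_iff.2 ⟨hQ, h⟩),
        by simpa [stage] using hσ, by simp, rfl⟩
    · exact ⟨(Arcs.cons_R_left_iff (.inr hS)).2 h, hσ, by simp, hS⟩

theorem ready_cons_D : ready (List.cons Step.D '' (List.cons Step.U '' T)) σ (d + 1) =
    push [Step.R, Step.D] [] '' raised (List.cons Step.U '' T) σ (d + 2) ∪
      push [Step.R] [] '' ready (List.cons Step.D '' (List.cons Step.U '' T)) σ (d + 2) := by
  ext ⟨Q, S⟩
  constructor
  · rintro ⟨h, hσ, hQ, hS⟩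
    rcases Q with _ | ⟨_ | _ | _ | _, Q⟩
    · exact absurd rfl (h.left_ne_nil (.inr hS))
    · exact absurd rfl (head?_ne_of_verts_mem rfl (by decide) h.word)
    · have hR := (Arcs.cons_R_left_iff (.inr hS)).1 h
      by_cases hD : Q.head? = some Step.D
      · obtain ⟨Q, rfl⟩ := List.head?_eq_some_iff.1 hD
        obtain ⟨hU, hQ⟩ := (Arcs.cons_D_left_iff hS).1 hR
        refine .inl ⟨(Q, S), ⟨hQ, hσ, ?_, hS⟩, rfl⟩
        rcases Q with _ | ⟨_ | _ | _ | _, Q⟩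
        · exact absurd rfl (hQ.left_ne_nil (.inr hS))
        · exact absurd rfl hU
        · rfl
        · exact absurd rfl (head?_ne_of_verts_mem rfl (by decide) hQ.word)
        · exact absurd List.mem_cons_self hQ.no_left
      · exact .inr ⟨(Q, S), ⟨hR, hσ, hD, hS⟩, rfl⟩
    · exact absurd rfl hQ
    · exact absurd List.mem_cons_self h.no_left
  · rintro (⟨⟨Q, S⟩, ⟨h, hσ, hQ, hS⟩, heq⟩ | ⟨⟨Q, S⟩, ⟨h, hσ, -, hS⟩, heq⟩) <;>
      obtain ⟨rfl, rfl⟩ := Prod.mk.inj heq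
    · exact ⟨(Arcs.cons_R_left_iff (.inr hS)).2 ((Arcs.cons_D_left_iff hS).2
        ⟨by simp_all, h⟩), hσ, by simp, hS⟩
    · exact ⟨(Arcs.cons_R_left_iff (.inr hS)).2 h, hσ, by simp, hS⟩

theorem raised_cons_U : raised (List.cons Step.U '' T) σ (d + 1) =
    push [Step.R, Step.U] [] '' ready T σ (d + 2) ∪
      push [Step.R] [] '' raised (List.cons Step.U '' T) σ (d + 2) := by
  ext ⟨Q, S⟩
  constructor
  · rintro ⟨h, hσ, hQ, hS⟩
    obtain ⟨Q, rfl⟩ := List.head?_eq_some_iff.1 hQ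
    have hR := (Arcs.cons_R_left_iff (.inr hS)).1 h
    rcases Q with _ | ⟨_ | _ | _ | _, Q⟩
    · exact absurd rfl (hR.left_ne_nil (.inr hS))
    · have hU := Arcs.cons_U_left_iff.1 hR
      exact .inl ⟨(Q, S), ⟨hU.2, hσ, hU.1, hS⟩, rfl⟩
    · exact .inr ⟨(Step.R :: Q, S), ⟨hR, hσ, rfl, hS⟩, rfl⟩
    · exact absurd rfl (head?_ne_of_verts_mem rfl (by decide) hR.word)
    · exact absurd List.mem_cons_self hR.no_left
  · rintro (⟨⟨Q, S⟩, ⟨h, hσ, hQ, hS⟩, heq⟩ | ⟨⟨Q, S⟩, ⟨h, hσ, -, hS⟩, heq⟩) <;>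
      obtain ⟨rfl, rfl⟩ := Prod.mk.inj heq
    · exact ⟨(Arcs.cons_R_left_iff (.inr hS)).2 (Arcs.cons_U_left_iff.2 ⟨hQ, h⟩), hσ, rfl, hS⟩
    · exact ⟨(Arcs.cons_R_left_iff (.inr hS)).2 h, hσ, rfl, hS⟩

theorem free_inc_succ : free V .inc (d + 1) =
    ready V .inc (d + 1) ∪ push [] [Step.L] '' free V .inc d := by
  ext ⟨Q, S⟩
  constructor
  · rintro ⟨h, hσ, hQ⟩
    rcases S with _ | ⟨_ | _ | _ | _, S⟩
    · exact absurd rfl h.right_ne_nil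
    · exact absurd List.mem_cons_self h.no_up
    · exact absurd List.mem_cons_self (stage_eq_inc.1 hσ)
    · exact .inl ⟨h, hσ, hQ, rfl⟩
    · have hL := Arcs.cons_L_right_iff.1 h
      exact .inr ⟨(Q, S), ⟨hL.2, stage_eq_inc.2 hL.1, hQ⟩, rfl⟩
  · rintro (⟨h, hσ, hQ, -⟩ | ⟨⟨Q, S⟩, ⟨h, hσ, hQ⟩, heq⟩)
    · exact ⟨h, hσ, hQ⟩
    · obtain ⟨rfl, rfl⟩ := Prod.mk.inj heq
      rw [stage_eq_inc] at hσ
      exact ⟨Arcs.cons_L_right_iff.2 ⟨hσ, h⟩, stage_eq_inc.2 (by simpa using hσ), hQ⟩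

theorem free_dec_succ : free V .dec (d + 1) = ready V .dec (d + 1) ∪
    push [] [Step.R] '' (ready V .inc (d + 2) ∪ free V .dec (d + 2)) := by
  ext ⟨Q, S⟩
  constructor
  · rintro ⟨h, hσ, hQ⟩
    rcases S with _ | ⟨_ | _ | _ | _, S⟩
    · exact absurd rfl h.right_ne_nil
    · exact absurd List.mem_cons_self h.no_up
    · obtain ⟨hL, hR⟩ := Arcs.cons_R_right_iff.1 h
      refine .inr ⟨(Q, S), ?_, rfl⟩
      cases hS : stage S
      · have hinc : (Q, S) ∈ free V .inc (d + 2) := ⟨hR, hS, hQ⟩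
        rw [free_inc_succ] at hinc
        refine .inl (hinc.resolve_right ?_)
        rintro ⟨c, -, hc⟩
        exact hL (by rw [← (Prod.mk.inj hc).2]; rfl)
      · exact .inr ⟨hR, hS, hQ⟩
    · exact .inl ⟨h, hσ, hQ, rfl⟩
    · have hR : Step.R ∈ S := by simpa using stage_eq_dec.1 hσ
      exact absurd hR (Arcs.cons_L_right_iff.1 h).1
  · rintro (⟨h, hσ, hQ, -⟩ | ⟨⟨Q, S⟩, hc, heq⟩)
    · exact ⟨h, hσ, hQ⟩
    · obtain ⟨rfl, rfl⟩ := Prod.mk.inj heq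
      have hS : Arcs V (d + 2) 0 (Q, S) ∧ Q.head? ≠ some Step.D ∧ S.head? ≠ some Step.L := by
        rcases hc with ⟨h, -, hQ, hS⟩ | ⟨h, hσ, hQ⟩
        · exact ⟨h, hQ, by rw [hS]; decide⟩
        · refine ⟨h, hQ, fun hL => ?_⟩
          obtain ⟨S, rfl⟩ := List.head?_eq_some_iff.1 hL
          exact (Arcs.cons_L_right_iff.1 h).1 (by simpa using stage_eq_dec.1 hσ)
      exact ⟨Arcs.cons_R_right_iff.2 ⟨hS.2.2, hS.1⟩, stage_eq_dec.2 List.mem_cons_self, hS.2.1⟩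

theorem free_zero : free V .inc 0 = {c | c = ([], []) ∧ [] ∈ V} := by
  ext ⟨Q, S⟩
  constructor
  · rintro ⟨h, -⟩
    have gap := h.gap
    have excess := h.excess
    dsimp only at gap excess
    have hnil : Q = [] ∧ S = [] := by
      by_contra hne
      have := h.disjoint Q S List.suffix_rfl List.suffix_rfl (by tauto)
        (by rw [Prod.snd_neg]; omega)
      rw [Prod.fst_neg] at this
      omega
    obtain ⟨rfl, rfl⟩ := hnil
    exact ⟨rfl, h.word⟩
  · rintro ⟨heq, hV⟩
    obtain ⟨rfl, rfl⟩ := Prod.mk.inj heq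
    exact ⟨⟨by simp, by simp, .nil, .nil, by simp, .nil, hV, by simp, rfl, rfl⟩, rfl, by simp⟩

end Decompositions

/-! ### Generating functions of pairs of arcs -/

/-- The weight of a pair: left steps on the right, up steps on the left. -/
def wt (c : Cfg) : Fin 2 →₀ ℕ :=
  Finsupp.single 0 (c.2.count Step.L) + Finsupp.single 1 (c.1.count Step.U)

theorem wt_eq_iff (c : Cfg) (n : Fin 2 →₀ ℕ) :
    wt c = n ↔ c.2.count Step.L = n 0 ∧ c.1.count Step.U = n 1 := by
  simp [Finsupp.ext_iff, Fin.forall_fin_two, wt]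

/-- The generating function of a set of pairs. -/
def gfs (s : Set Cfg) : Ser := fun n => ({c ∈ s | wt c = n}.ncard : ℚ)

theorem coeff_gfs (s : Set Cfg) (n : Fin 2 →₀ ℕ) :
    MvPowerSeries.coeff n (gfs s) = ({c ∈ s | wt c = n}.ncard : ℚ) := rfl

theorem gfs_empty : gfs ∅ = 0 := by
  ext n
  simp [coeff_gfs]

theorem gfs_singleton_nil : gfs {([], [])} = 1 := by
  ext n
  have hwt : wt ([], []) = 0 := by simp [wt]
  rw [coeff_gfs, MvPowerSeries.coeff_one]
  split_ifs with hn
  · have h : {c ∈ ({([], [])} : Set Cfg) | wt c = n} = {([], [])} := by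
      ext c
      simp only [Set.mem_ofPred_eq, Set.mem_singleton_iff, and_iff_left_iff_imp]
      rintro rfl
      rw [hwt, hn]
    rw [h, Set.ncard_singleton, Nat.cast_one]
  · have h : {c ∈ ({([], [])} : Set Cfg) | wt c = n} = ∅ := by
      ext c
      simp only [Set.mem_ofPred_eq, Set.mem_singleton_iff, Set.mem_empty_iff_false, iff_false]
      rintro ⟨rfl, h⟩
      exact hn (by rw [← h, hwt])
    rw [h, Set.ncard_empty, Nat.cast_zero]

theorem push_injective (p q : List Step) : (push p q).Injective := by
  rintro ⟨a, b⟩ ⟨a', b'⟩ h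
  simp only [push, Prod.mk.injEq, List.append_cancel_left_eq] at h
  rw [h.1, h.2]

theorem wt_push (p q : List Step) (c : Cfg) : wt (push p q c) =
    Finsupp.single 0 (q.count Step.L) + Finsupp.single 1 (p.count Step.U) + wt c := by
  simp only [wt, push, List.count_append, Finsupp.single_add]
  abel

theorem gfs_push (p q : List Step) (s : Set Cfg) : gfs (push p q '' s) =
    x ^ q.count Step.L * y ^ p.count Step.U * gfs s := by
  set e : Fin 2 →₀ ℕ := Finsupp.single 0 (q.count Step.L) + Finsupp.single 1 (p.count Step.U)
  have hxy : x ^ q.count Step.L * y ^ p.count Step.U = MvPowerSeries.monomial e (1 : ℚ) := by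
    rw [x, y, MvPowerSeries.X_pow_eq, MvPowerSeries.X_pow_eq, MvPowerSeries.monomial_mul_monomial,
      one_mul]
  ext n
  rw [hxy, MvPowerSeries.coeff_monomial_mul, coeff_gfs, coeff_gfs, one_mul]
  split_ifs with he
  · rw [← Set.ncard_image_of_injective {c ∈ s | wt c = n - e} (push_injective p q)]
    congr 2
    ext c
    simp only [Set.mem_ofPred_eq, Set.mem_image]
    constructor
    · rintro ⟨⟨c, hc, rfl⟩, rfl⟩
      exact ⟨c, ⟨hc, by rw [wt_push, add_tsub_cancel_left]⟩, rfl⟩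
    · rintro ⟨c, ⟨hc, h⟩, rfl⟩
      exact ⟨⟨c, hc, rfl⟩, by rw [wt_push, h, add_tsub_cancel_of_le he]⟩
  · rw [Nat.cast_eq_zero]
    convert Set.ncard_empty Cfg
    ext c
    simp only [Set.mem_ofPred_eq, Set.mem_image, Set.mem_empty_iff_false, iff_false]
    rintro ⟨⟨c, _, rfl⟩, rfl⟩
    exact he (by rw [wt_push]; exact le_self_add)

instance : Finite Step := Finite.of_surjective
  (fun i : Fin 4 => match i with | 0 => Step.U | 1 => Step.R | 2 => Step.D | 3 => Step.L) (by
    rintro (_ | _ | _ | _)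
    exacts [⟨0, rfl⟩, ⟨1, rfl⟩, ⟨2, rfl⟩, ⟨3, rfl⟩])

theorem Arcs.counts {V : Set (List Step)} {d e : ℕ} {c : Cfg} (h : Arcs V d e c) :
    c.1.count Step.L = 0 ∧ c.2.count Step.U = 0 ∧
      c.2.count Step.L = d + c.1.count Step.R + c.2.count Step.R ∧
      c.1.count Step.U = e + c.1.count Step.D + c.2.count Step.D := by
  have hL := List.count_eq_zero.2 h.no_left
  have hU := List.count_eq_zero.2 h.no_up
  have gap := h.gap
  have excess := h.excess
  rw [endp_eq, endp_eq] at gap excess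
  dsimp only at gap excess
  omega

theorem finite_of_arcs {s : Set Cfg} (h : ∀ c ∈ s, ∃ V d e, Arcs V d e c) (n : Fin 2 →₀ ℕ) :
    {c ∈ s | wt c = n}.Finite := by
  refine Set.Finite.subset ((List.finite_length_le Step (n 0 + n 1 + n 1)).prod
    (List.finite_length_le Step (n 0 + n 1 + n 0))) ?_
  rintro c ⟨hc, hw⟩
  obtain ⟨V, d, e, hV⟩ := h c hc
  rw [wt_eq_iff] at hw
  have := hV.counts
  constructor
  · change c.1.length ≤ _
    rw [length_eq_counts]; omega
  · change c.2.length ≤ _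
    rw [length_eq_counts]; omega

theorem gfs_of_eq_union {r s t : Set Cfg} (h : r = s ∪ t) (hst : Disjoint s t)
    (hr : ∀ c ∈ r, ∃ V d e, Arcs V d e c) : gfs r = gfs s + gfs t := by
  subst h
  ext n
  rw [map_add, coeff_gfs, coeff_gfs, coeff_gfs, ← Nat.cast_add, ← Set.ncard_union_eq
    (hst.mono (fun c hc => hc.1) (fun c hc => hc.1))
    (finite_of_arcs (fun c hc => hr c (.inl hc)) n) (finite_of_arcs (fun c hc => hr c (.inr hc)) n)]
  congr 2
  ext c
  simp only [Set.mem_ofPred_eq, Set.mem_union, or_and_right]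

theorem x_pow_dvd_gfs {s : Set Cfg} {d : ℕ} (h : ∀ c ∈ s, ∃ V e, Arcs V d e c) :
    x ^ d ∣ gfs s := by
  rw [x, MvPowerSeries.X_pow_dvd_iff]
  intro m hm
  rw [coeff_gfs, Nat.cast_eq_zero]
  convert Set.ncard_empty Cfg
  ext c
  simp only [Set.mem_ofPred_eq, Set.mem_empty_iff_false, iff_false]
  rintro ⟨hc, hw⟩
  obtain ⟨V, e, hV⟩ := h c hc
  have := hV.counts
  rw [wt_eq_iff] at hw
  omega

section Equations

variable {V T W : Set (List Step)} {σ : Stage} {d : ℕ}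

theorem gfs_ready_union (h : Disjoint V W) :
    gfs (ready (V ∪ W) σ d) = gfs (ready V σ d) + gfs (ready W σ d) := by
  refine gfs_of_eq_union ?_ ?_ fun c hc => ⟨_, _, _, hc.1⟩
  · ext c
    constructor
    · rintro ⟨hc, hc'⟩
      exact hc.word.imp (fun hV => ⟨{ hc with word := hV }, hc'⟩)
        fun hW => ⟨{ hc with word := hW }, hc'⟩
    · rintro (⟨hc, hc'⟩ | ⟨hc, hc'⟩)
      · exact ⟨{ hc with word := .inl hc.word }, hc'⟩
      · exact ⟨{ hc with word := .inr hc.word }, hc'⟩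
  · exact Set.disjoint_left.2 fun c hV hW => h.notMem_of_mem_left hV.1.word hW.1.word

theorem gfs_ready_cons_U : gfs (ready (List.cons Step.U '' T) σ (d + 1)) =
    y * gfs (free T σ (d + 1)) + gfs (ready (List.cons Step.U '' T) σ (d + 2)) := by
  rw [gfs_of_eq_union ready_cons_U ?_ fun c hc => ⟨_, _, _, hc.1⟩, gfs_push, gfs_push]
  · simp
  · rw [Set.disjoint_left]
    rintro _ ⟨c, -, rfl⟩ ⟨c', -, h⟩
    simp [push] at h

theorem gfs_ready_cons_D : gfs (ready (List.cons Step.D '' (List.cons Step.U '' T)) σ (d + 1)) =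
    gfs (raised (List.cons Step.U '' T) σ (d + 2)) +
      gfs (ready (List.cons Step.D '' (List.cons Step.U '' T)) σ (d + 2)) := by
  rw [gfs_of_eq_union ready_cons_D ?_ fun c hc => ⟨_, _, _, hc.1⟩, gfs_push, gfs_push]
  · simp
  · rw [Set.disjoint_left]
    rintro _ ⟨c, -, rfl⟩ ⟨c', hc', h⟩
    have hD := hc'.2.2.1
    simp_all [push]

theorem gfs_raised_cons_U : gfs (raised (List.cons Step.U '' T) σ (d + 1)) =
    y * gfs (ready T σ (d + 2)) + gfs (raised (List.cons Step.U '' T) σ (d + 2)) := by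
  rw [gfs_of_eq_union raised_cons_U ?_ fun c hc => ⟨_, _, _, hc.1⟩, gfs_push, gfs_push]
  · simp
  · rw [Set.disjoint_left]
    rintro _ ⟨c, -, rfl⟩ ⟨c', hc', h⟩
    have hR := hc'.2.2.1
    simp_all [push]

theorem gfs_free_inc : gfs (free V .inc (d + 1)) =
    gfs (ready V .inc (d + 1)) + x * gfs (free V .inc d) := by
  rw [gfs_of_eq_union free_inc_succ ?_ fun c hc => ⟨_, _, _, hc.1⟩, gfs_push]
  · simp
  · rw [Set.disjoint_left]
    rintro _ ⟨-, -, -, hS⟩ ⟨c, -, rfl⟩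
    simp [push] at hS

theorem gfs_free_dec : gfs (free V .dec (d + 1)) = gfs (ready V .dec (d + 1)) +
    (gfs (ready V .inc (d + 2)) + gfs (free V .dec (d + 2))) := by
  rw [gfs_of_eq_union free_dec_succ ?_ fun c hc => ⟨_, _, _, hc.1⟩, gfs_push,
    gfs_of_eq_union rfl ?_ ?_]
  · simp
  · rw [Set.disjoint_left]
    rintro c ⟨-, hinc, -⟩ ⟨-, hdec, -⟩
    rw [hinc] at hdec
    cases hdec
  · rintro c (hc | hc) <;> exact ⟨_, _, _, hc.1⟩
  · rw [Set.disjoint_left]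
    rintro _ ⟨-, -, -, hS⟩ ⟨c, -, rfl⟩
    simp [push] at hS

theorem gfs_ready_indent {e : ℕ → ℕ → Ser} (he : IsTailSum e)
    (hE : ∀ d, gfs (ready T σ (d + 1)) = e 0 (d + 1)) :
    gfs (ready (List.cons Step.D '' (List.cons Step.U '' T)) σ (d + 1)) = y * e 2 (d + 3) :=
  he.indent (E := fun d => gfs (ready T σ d))
    (D := fun d => gfs (ready (List.cons Step.D '' (List.cons Step.U '' T)) σ d)) hE
    (fun _ => gfs_raised_cons_U) (fun _ => gfs_ready_cons_D)
    (fun _ => x_pow_dvd_gfs fun _ hc => ⟨_, _, hc.1⟩)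
    (fun _ => x_pow_dvd_gfs fun _ hc => ⟨_, _, hc.1⟩) d

end Equations

/-! ### Pairs with prescribed indents -/

/-- The words of `W` with any number of up steps put in front. -/
def above (W : Set (List Step)) : Set (List Step) :=
  {v | ∃ c, ∃ w ∈ W, v = List.replicate c Step.U ++ w}

theorem above_eq_union (W : Set (List Step)) : above W = List.cons Step.U '' above W ∪ W := by
  ext v
  constructor
  · rintro ⟨_ | c, w, hw, rfl⟩
    · exact .inr hw
    · exact .inl ⟨_, ⟨c, w, hw, rfl⟩, rfl⟩
  · rintro (⟨_, ⟨c, w, hw, rfl⟩, rfl⟩ | hv)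
    · exact ⟨c + 1, w, hw, rfl⟩
    · exact ⟨0, v, hv, rfl⟩

section Above

variable {W : Set (List Step)}

theorem gfs_ready_above (hW : ∀ v, Step.U :: v ∉ W) (σ : Stage) (d : ℕ) :
    gfs (ready (above W) σ d) =
      gfs (ready (List.cons Step.U '' above W) σ d) + gfs (ready W σ d) := by
  rw [← gfs_ready_union, ← above_eq_union]
  rw [Set.disjoint_left]
  rintro _ ⟨v, -, rfl⟩ hv
  exact hW v hv

theorem nil_mem_above : [] ∈ above W ↔ [] ∈ W := by
  rw [above_eq_union]
  simp

theorem rowSystem_gfs (hW : ∀ v, Step.U :: v ∉ W) :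
    RowSystem (gfs (free (above W) .inc 0)) (fun σ d => gfs (ready W σ d))
      (fun σ d => gfs (ready (List.cons Step.U '' above W) σ d))
      (fun σ d => gfs (free (above W) σ d)) where
  ready _ _ := gfs_ready_cons_U
  init := rfl
  inc d := by rw [gfs_free_inc, gfs_ready_above hW]
  dec d := by
    rw [gfs_free_dec, gfs_ready_above hW, gfs_ready_above hW]
    ring
  tail _ _ := x_pow_dvd_gfs fun _ hc => ⟨_, _, hc.1⟩
  tail_dec _ := x_pow_dvd_gfs fun _ hc => ⟨_, _, hc.1⟩

theorem gfs_free_zero_of_nil_notMem (hW : [] ∉ W) : gfs (free (above W) .inc 0) = 0 := by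
  have h : free (above W) .inc 0 = ∅ := by
    rw [free_zero]
    exact Set.eq_empty_of_forall_notMem fun c hc => hW (nil_mem_above.1 hc.2)
  rw [h, gfs_empty]

end Above

/-- The reversed vertical words of the left arcs without indents. -/
def unindented : Set (List Step) := above {[]}

/-- The reversed words that end in an indent, with a word of `T` below it. -/
def indentOn (T : Set (List Step)) : Set (List Step) := List.cons Step.D '' (List.cons Step.U '' T)

/-- The reversed vertical words with one indent that begin with an up step. -/
def oneIndent : Set (List Step) := List.cons Step.U '' above (indentOn unindented)

/-- The reversed vertical words with two indents at different heights. -/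
def farIndents : Set (List Step) := List.cons Step.U '' above (indentOn oneIndent)

/-- The reversed vertical words with two indents at the same height. -/
def nearIndents : Set (List Step) := List.cons Step.U '' above (indentOn (indentOn unindented))

theorem cons_U_notMem_indentOn (T : Set (List Step)) (v : List Step) :
    Step.U :: v ∉ indentOn T := by
  simp [indentOn]

theorem nil_notMem_indentOn (T : Set (List Step)) : [] ∉ indentOn T := by
  simp [indentOn]

section Values

variable (σ : Stage) (d : ℕ)

theorem ready_nil : ready {[]} σ d = ∅ := by
  refine Set.eq_empty_of_forall_notMem ?_
  rintro ⟨Q, S⟩ ⟨h, -, -, hS⟩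
  obtain ⟨Q, q, rfl⟩ := (List.eq_nil_or_concat' Q).resolve_left (h.left_ne_nil (.inr hS))
  have hq : q = Step.U := h.start q (by simp)
  have hword : verts (Q ++ [q]) = [] := h.word
  simp [verts, hq] at hword

theorem gfs_ready_unindented : gfs (ready unindented σ (d + 1)) = y * expo 1 σ (d + 1) := by
  have hW (v : List Step) : Step.U :: v ∉ ({[]} : Set (List Step)) := by simp
  have init : gfs (free unindented .inc 0) = 1 := by
    rw [free_zero, ← gfs_singleton_nil]
    congr 1
    ext c
    simp [unindented, nil_mem_above]
  have H := rowSystem_gfs hW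
  rw [← unindented, init, unindented] at H
  rw [unindented, gfs_ready_above hW, H.unique rowSystem_expo, ready_nil, gfs_empty, add_zero]
  intro σ d
  rw [ready_nil, gfs_empty]
  rfl

theorem gfs_ready_indentOn_unindented :
    gfs (ready (indentOn unindented) σ (d + 1)) = y ^ 2 * expo 3 σ (d + 3) := by
  rw [indentOn, gfs_ready_indent ((IsTailSum.expo σ 1 0).smul y) (gfs_ready_unindented σ)]
  ring

theorem gfs_ready_oneIndent :
    gfs (ready oneIndent σ (d + 1)) = y ^ 3 * I * dy (expo 1 σ (d + 1)) := by
  have H := rowSystem_gfs (cons_U_notMem_indentOn unindented)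
  rw [gfs_free_zero_of_nil_notMem (nil_notMem_indentOn _)] at H
  have H' := rowSystem_dy_expo.smul (y ^ 2 * I)
  rw [mul_zero] at H'
  rw [oneIndent, H.unique H']
  · ring
  · intro σ d
    rw [gfs_ready_indentOn_unindented, mul_assoc, I_mul_expo]

theorem gfs_ready_farIndents :
    gfs (ready farIndents σ (d + 1)) = y ^ 5 * twice (expo 1 σ (d + 1)) := by
  have H := rowSystem_gfs (cons_U_notMem_indentOn oneIndent)
  rw [gfs_free_zero_of_nil_notMem (nil_notMem_indentOn _)] at H
  obtain ⟨B, hB⟩ := rowSystem_twice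
  have H' := hB.smul (y ^ 4)
  rw [mul_zero] at H'
  rw [farIndents, H.unique H']
  · ring
  · intro σ d
    rw [indentOn, gfs_ready_indent ((IsTailSum.expo σ 1 0).dy.smul (y ^ 3 * I))
      (gfs_ready_oneIndent σ), I_mul_expo]
    ring

theorem gfs_ready_nearIndents :
    gfs (ready nearIndents σ (d + 1)) = y ^ 4 * (I ^ 2 * dy (expo 1 σ (d + 1))) := by
  have H := rowSystem_gfs (cons_U_notMem_indentOn (indentOn unindented))
  rw [gfs_free_zero_of_nil_notMem (nil_notMem_indentOn _)] at H
  have H' := rowSystem_dy_expo.smul (y ^ 3 * I ^ 2)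
  rw [mul_zero] at H'
  rw [nearIndents, H.unique H']
  · ring
  · intro σ d
    rw [indentOn, gfs_ready_indent ((IsTailSum.expo σ 3 2).smul (y ^ 2))
      (gfs_ready_indentOn_unindented σ), mul_assoc, pow_two I, mul_assoc I, I_mul_expo, I_mul_expo]
    ring

end Values

/-! ### The polygon of a closed pair -/

theorem endp_append (l l' : List Step) : endp (l ++ l') = endp l + endp l' := by
  simp [endp]

theorem endp_reverse (l : List Step) : endp l.reverse = endp l := by
  rw [endp, List.map_reverse, List.sum_reverse, endp]

theorem endp_ne_zero {l : List Step} (hl : l ≠ []) (hchain : l.IsChain fun s t => s.vec + t.vec ≠ 0)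
    (h : Step.L ∉ l ∨ Step.U ∉ l) : endp l ≠ 0 := by
  intro h0
  rw [endp_eq, Prod.mk_eq_zero] at h0
  have eq_or_opposite : ∀ s ∈ l, ∀ t ∈ l, s = t ∨ s.vec + t.vec = 0 := by
    have hLR : Step.L ∈ l ↔ Step.R ∈ l := by simp only [← List.count_pos_iff]; omega
    have hUD : Step.U ∈ l ↔ Step.D ∈ l := by simp only [← List.count_pos_iff]; omega
    rintro (_ | _ | _ | _) hs (_ | _ | _ | _) ht <;> first | exact .inl rfl | exact .inr rfl | tauto
  have hconst : l.Pairwise (· = ·) := List.isChain_iff_pairwise.1 <|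
    hchain.imp_of_mem_imp fun s t hs ht hst => (eq_or_opposite s hs t ht).resolve_right hst
  obtain ⟨s, l, rfl⟩ := List.exists_cons_of_ne_nil hl
  have hpos : 0 < (s :: l).count s := List.count_pos_iff.2 List.mem_cons_self
  have hzero : ∀ t ≠ s, (s :: l).count t = 0 := fun t ht => List.count_eq_zero.2 fun hm =>
    (List.mem_cons.1 hm).elim ht fun hm => ht ((List.pairwise_cons.1 hconst).1 t hm).symm
  cases s <;> simp only [hzero, ne_eq, reduceCtorEq, not_false_eq_true] at h0 <;> omega

/-- The boundary word of the polygon formed by two arcs, closed by a right step from the left to the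
right one. -/
def glue (c : Cfg) : List Step := c.1.reverse ++ Step.R :: c.2

/-- The reversed vertical words of arcs with `m` down steps that end at their highest point. -/
def summits (m : ℕ) : Set (List Step) :=
  {v | v.count Step.D = m ∧ ∀ v', v' <:+ v → (endp v').2 ≤ (endp v).2}

theorem verts_reverse (l : List Step) : verts l.reverse = (verts l).reverse :=
  List.filter_reverse

theorem count_verts {s : Step} (hs : s = Step.U ∨ s = Step.D) (l : List Step) :
    (verts l).count s = l.count s :=
  List.count_filter (by simpa using hs)

theorem endp_verts_snd (l : List Step) : (endp (verts l)).2 = (endp l).2 := by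
  simp only [endp_eq, count_verts (.inl rfl), count_verts (.inr rfl)]

theorem pos_eq_endp (w : List Step) (i : ℕ) : pos w i = endp (w.take i) := rfl

theorem pos_glue_left {Q Q' : List Step} (S : List Step) (h : Q' <:+ Q) :
    pos (glue (Q, S)) Q'.length = endp Q' := by
  obtain ⟨P, rfl⟩ := h
  rw [pos_eq_endp, glue, List.reverse_append, List.append_assoc, List.take_left' (by simp),
    endp_reverse]

theorem pos_glue_right {Q S S' : List Step} (hclosed : endp (glue (Q, S)) = 0) (hS' : S' <:+ S)
    {i : ℕ} (hi : i + S'.length = (glue (Q, S)).length) : pos (glue (Q, S)) i = -endp S' := by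
  obtain ⟨P, rfl⟩ := hS'
  have hglue : glue (Q, P ++ S') = (Q.reverse ++ Step.R :: P) ++ S' := by simp [glue]
  rw [hglue] at hi hclosed ⊢
  rw [endp_append] at hclosed
  rw [pos_eq_endp, List.take_left' (by simp at hi ⊢; omega)]
  exact eq_neg_of_add_eq_zero_left hclosed

theorem length_glue (c : Cfg) : (glue c).length = c.1.length + 1 + c.2.length := by
  simp [glue]
  omega

section Closed

variable {V : Set (List Step)} {Q S : List Step}

namespace Arcs

theorem endp_glue (h : Arcs V 1 0 (Q, S)) : endp (glue (Q, S)) = 0 := by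
  have gap := h.gap
  have excess := h.excess
  dsimp only at gap excess
  rw [glue, endp_append, endp_cons, endp_reverse, Prod.ext_iff]
  simp only [Prod.fst_add, Prod.snd_add, Step.vec, Prod.fst_zero, Prod.snd_zero]
  omega

theorem pos_glue (h : Arcs V 1 0 (Q, S)) {i : ℕ} (hi : i ≤ (glue (Q, S)).length) :
    (∃ Q', Q' <:+ Q ∧ Q'.length = i ∧ pos (glue (Q, S)) i = endp Q') ∨
      ∃ S', S' <:+ S ∧ i + S'.length = (glue (Q, S)).length ∧ pos (glue (Q, S)) i = -endp S' := by
  have hlen := length_glue (Q, S)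
  dsimp only at hlen
  rcases le_or_gt i Q.length with hiQ | hQi
  · have hi' : (Q.drop (Q.length - i)).length = i := by simp; omega
    refine .inl ⟨_, List.drop_suffix _ _, hi', ?_⟩
    rw [← pos_glue_left S (List.drop_suffix (Q.length - i) Q), hi']
  · have hi' : i + (S.drop (i - Q.length - 1)).length = (glue (Q, S)).length := by simp; omega
    exact .inr ⟨_, List.drop_suffix _ _, hi', pos_glue_right h.endp_glue (List.drop_suffix _ _) hi'⟩

theorem pos_glue_ne (h : Arcs V 1 0 (Q, S)) {i j : ℕ} (hij : i < j)
    (hj : j < (glue (Q, S)).length) : pos (glue (Q, S)) i ≠ pos (glue (Q, S)) j := by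
  have hlen := length_glue (Q, S)
  dsimp only at hlen
  rcases h.pos_glue (hij.trans hj).le with ⟨Q₁, hQ₁, hi, hpi⟩ | ⟨S₁, hS₁, hi, hpi⟩ <;>
    rcases h.pos_glue hj.le with ⟨Q₂, hQ₂, hj', hpj⟩ | ⟨S₂, hS₂, hj', hpj⟩ <;> rw [hpi, hpj]
  · obtain ⟨P, rfl⟩ := List.suffix_of_suffix_length_le hQ₁ hQ₂ (by omega)
    have hP : P ≠ [] := by rintro rfl; simp at hj'; omega
    rw [endp_append]
    have no_left : Step.L ∉ P := fun hL => h.no_left (hQ₂.mem (List.mem_append_left _ hL))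
    have chain := (h.chain_left.suffix hQ₂).left_of_append
    exact (add_ne_right.2 (endp_ne_zero hP chain (.inl no_left))).symm
  · intro heq
    refine (h.disjoint Q₁ S₂ hQ₁ hS₂ (.inr ?_) (by rw [heq])).ne (by rw [heq])
    rintro rfl
    simp at hj'
    omega
  · have := hS₁.length_le
    have := hQ₂.length_le
    omega
  · obtain ⟨P, rfl⟩ := List.suffix_of_suffix_length_le hS₂ hS₁ (by omega)
    have hP : P ≠ [] := by rintro rfl; simp at hi; omega
    rw [endp_append, ne_eq, neg_inj]
    refine add_ne_right.2 (endp_ne_zero hP (h.chain_right.suffix hS₁).left_of_append (.inr ?_))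
    exact fun hU => h.no_up (hS₁.mem (List.mem_append_left _ hU))

theorem left_fst_nonneg {d e : ℕ} {c : Cfg} (h : Arcs V d e c) {Q' : List Step}
    (hQ' : Q' <:+ c.1) : 0 ≤ (endp Q').1 :=
  endp_fst_le_of_suffix (fun hL => h.no_left (hQ'.mem hL)) List.nil_suffix

theorem left_snd_pos {d e : ℕ} {c : Cfg} (h : Arcs V d e c) {Q' : List Step} (hQ' : Q' <:+ c.1)
    (hne : Q' ≠ []) : 0 < (endp Q').2 := by
  induction Q' with
  | nil => exact absurd rfl hne
  | cons s Q' ih =>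
    have hx := h.left_fst_nonneg hQ'
    have ground : (endp (s :: Q')).2 = 0 → (endp (s :: Q')).1 < 0 :=
      h.disjoint (s :: Q') [] hQ' List.nil_suffix (.inl hne)
    have ih := ih ((List.suffix_cons s Q').trans hQ')
    have hs : Q' = [] → s = Step.U := by
      rintro rfl
      obtain ⟨P, hP⟩ := hQ'
      exact h.start s (by simp [← hP])
    rw [endp_cons] at hx ground ⊢
    rcases eq_or_ne Q' [] with rfl | hQ'
    · simp [hs rfl, Step.vec, endp]
    · have := ih hQ'
      cases s <;> simp [Step.vec] at hx ground ⊢ <;> omega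

theorem right_fst_nonneg {d e : ℕ} {c : Cfg} (h : Arcs V d e c) {S' : List Step}
    (hS' : S' <:+ c.2) : 0 ≤ (-endp S').1 := by
  have gap := h.gap
  have hx := h.left_fst_nonneg List.suffix_rfl
  have ordered := h.ordered
  obtain ⟨P, hP⟩ := hS'
  rw [← hP, endp_append, endp_eq P, endp_eq S'] at gap
  rw [← hP, List.pairwise_append] at ordered
  simp only [Prod.fst_add, endp_eq S', Prod.fst_neg] at gap ⊢
  by_cases hR : Step.R ∈ S'
  · have hL : P.count Step.L = 0 :=
      List.count_eq_zero.2 fun hL => ordered.2.2 _ hL _ hR rfl rfl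
    omega
  · rw [List.count_eq_zero.2 hR]
    omega

theorem right_snd {d e : ℕ} {c : Cfg} (h : Arcs V d e c) {S' : List Step} (hS' : S' <:+ c.2) :
    (-endp S').2 = S'.count Step.D := by
  have hU : S'.count Step.U = 0 := List.count_eq_zero.2 fun hU => h.no_up (hS'.mem hU)
  simp [endp_eq, hU]

theorem isRootedPolygon_glue (h : Arcs V 1 0 (Q, S)) (hS : S.head? = some Step.D) :
    IsRootedPolygon (glue (Q, S)) where
  four_le := by
    have hD : 0 < S.count Step.D := List.count_pos_iff.2 (List.mem_of_mem_head? hS)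
    have hcounts := h.counts
    have := length_eq_counts Q
    have := length_eq_counts S
    rw [length_glue]
    dsimp only at hcounts ⊢
    omega
  closed := by
    rw [pos_eq_endp, List.take_length, h.endp_glue]
  simple _ _ := h.pos_glue_ne
  nonneg i hi := by
    rcases h.pos_glue hi with ⟨Q', hQ', -, hp⟩ | ⟨S', hS', -, hp⟩ <;> rw [hp]
    · refine ⟨h.left_fst_nonneg hQ', ?_⟩
      rcases eq_or_ne Q' [] with rfl | hne
      · rfl
      · exact (h.left_snd_pos hQ' hne).le
    · exact ⟨h.right_fst_nonneg hS', by rw [h.right_snd hS']; positivity⟩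
  start := by
    obtain ⟨Q, q, rfl⟩ := (List.eq_nil_or_concat' Q).resolve_left (h.left_ne_nil (.inr hS))
    obtain rfl := h.start q (by simp)
    simp [glue]

end Arcs

theorem eq_of_suffix_of_count_eq {S : List Step} (hS : S.head? = some Step.D)
    {S' : List Step} (hS' : S' <:+ S) (hcount : S'.count Step.D = S.count Step.D) : S' = S := by
  obtain ⟨T, rfl⟩ := List.head?_eq_some_iff.1 hS
  refine (List.suffix_cons_iff.1 hS').resolve_right fun hT => ?_
  have := hT.sublist.count_le Step.D
  rw [List.count_cons_self] at hcount
  omega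

theorem height_eq_of_forall {w : List Step} {k : ℕ} (hle : ∀ i ≤ w.length, (pos w i).2 ≤ k)
    {n : ℕ} (hn : n ≤ w.length) (hk : (pos w n).2 = k) : height w = k := by
  refine le_antisymm (Finset.sup_le fun i hi => ?_) ?_
  · exact Int.toNat_le.2 (hle i (Finset.mem_range_succ_iff.1 hi))
  · have := Finset.le_sup (f := fun i => (pos w i).2.toNat) (Finset.mem_range_succ_iff.2 hn)
    rwa [hk, Int.toNat_natCast] at this

theorem width_eq_of_forall {w : List Step} {k : ℕ} (hle : ∀ i ≤ w.length, (pos w i).1 ≤ k)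
    {n : ℕ} (hn : n ≤ w.length) (hk : (pos w n).1 = k) : width w = k := by
  refine le_antisymm (Finset.sup_le fun i hi => ?_) ?_
  · exact Int.toNat_le.2 (hle i (Finset.mem_range_succ_iff.1 hi))
  · have := Finset.le_sup (f := fun i => (pos w i).1.toNat) (Finset.mem_range_succ_iff.2 hn)
    rwa [hk, Int.toNat_natCast] at this

theorem leftArc_eq_of_forall {w : List Step} {n : ℕ} (hn : n ≤ w.length)
    (htop : (pos w n).2 = height w) (hlast : ∀ i ≤ w.length, (pos w i).2 = height w → i ≤ n) :
    leftArc w = w.take n := by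
  rw [leftArc]
  congr 1
  refine le_antisymm (Finset.sup_le fun i hi => ?_) (Finset.le_sup (f := id) ?_)
  · rw [Finset.mem_filter, Finset.mem_range_succ_iff] at hi
    exact hlast i hi.1 hi.2
  · exact Finset.mem_filter.2 ⟨Finset.mem_range_succ_iff.2 hn, htop⟩

namespace Arcs

theorem width_glue (h : Arcs V 1 0 (Q, S)) : width (glue (Q, S)) = S.count Step.L := by
  have hcounts := h.counts
  have ordered := h.ordered
  obtain ⟨P, T, rfl, hP⟩ := List.eq_append_cons_of_mem
    (List.count_pos_iff.1 (show 0 < S.count Step.L by dsimp only at hcounts; omega))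
  have hT : T.count Step.R = 0 := List.count_eq_zero.2 fun hR =>
    (List.pairwise_cons.1 (List.pairwise_append.1 ordered).2.1).1 _ hR rfl rfl
  have hlen := length_glue (Q, P ++ Step.L :: T)
  refine width_eq_of_forall (fun i hi => ?_)
    (n := (glue (Q, P ++ Step.L :: T)).length - (Step.L :: T).length) (by omega) ?_
  · rcases h.pos_glue hi with ⟨Q', hQ', -, hp⟩ | ⟨S', hS', -, hp⟩ <;> rw [hp]
    · have := endp_fst_le_of_suffix h.no_left hQ'
      have gap := h.gap
      simp only [endp_eq] at this gap ⊢
      omega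
    · have := hS'.sublist.count_le Step.L
      simp only [endp_eq, Prod.fst_neg]
      omega
  · rw [pos_glue_right h.endp_glue (List.suffix_append P _) (by simp at hlen ⊢; omega)]
    simp [endp_eq, hT, List.count_eq_zero.2 hP]

theorem snd_le_count_of_suffix {m : ℕ} (h : Arcs V 1 0 (Q, S)) (hV : V ⊆ summits m)
    {Q' : List Step} (hQ' : Q' <:+ Q) : (endp Q').2 ≤ S.count Step.D := by
  have htop := (hV h.word).2 (verts Q') (hQ'.filter _)
  have hcounts := h.counts
  rw [endp_verts_snd, endp_verts_snd, endp_eq Q] at htop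
  dsimp only at htop hcounts
  omega

theorem height_glue {m : ℕ} (h : Arcs V 1 0 (Q, S)) (hV : V ⊆ summits m) :
    height (glue (Q, S)) = S.count Step.D := by
  have hlen := length_glue (Q, S)
  dsimp only at hlen
  refine height_eq_of_forall (fun i hi => ?_) (n := Q.length + 1) (by omega) ?_
  · rcases h.pos_glue hi with ⟨Q', hQ', -, hp⟩ | ⟨S', hS', -, hp⟩ <;> rw [hp]
    · exact h.snd_le_count_of_suffix hV hQ'
    · rw [h.right_snd hS']
      exact_mod_cast hS'.sublist.count_le Step.D
  · rw [pos_glue_right h.endp_glue List.suffix_rfl (by omega), h.right_snd List.suffix_rfl]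

theorem leftArc_glue {m : ℕ} (h : Arcs V 1 0 (Q, S)) (hV : V ⊆ summits m)
    (hS : S.head? = some Step.D) : leftArc (glue (Q, S)) = Q.reverse ++ [Step.R] := by
  have hlen := length_glue (Q, S)
  dsimp only at hlen
  rw [leftArc_eq_of_forall (n := Q.length + 1) (by omega)]
  · simp [glue, List.take_append]
  · rw [pos_glue_right h.endp_glue List.suffix_rfl (by omega), h.right_snd List.suffix_rfl,
      h.height_glue hV]
  · intro i hi htop
    rcases h.pos_glue hi with ⟨Q', hQ', rfl, -⟩ | ⟨S', hS', hi', hp⟩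
    · exact hQ'.length_le.trans (Nat.le_succ _)
    · rw [hp, h.right_snd hS', h.height_glue hV, Nat.cast_inj] at htop
      rw [eq_of_suffix_of_count_eq hS hS' htop] at hi'
      omega

theorem isUnimodal_glue {m : ℕ} (h : Arcs V 1 0 (Q, S)) (hV : V ⊆ summits m)
    (hS : S.head? = some Step.D) : IsUnimodal m (glue (Q, S)) := by
  refine ⟨h.isRootedPolygon_glue hS, ?_⟩
  have hcounts := h.counts
  have hm : Q.count Step.D = m := (count_verts (.inr rfl) Q).symm.trans (hV h.word).1
  have := length_eq_counts Q
  have := length_eq_counts S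
  rw [length_glue, h.width_glue, h.height_glue hV]
  dsimp only at hcounts ⊢
  omega

theorem exists_pos_glue_eq_corner_iff {m : ℕ} (h : Arcs V 1 0 (Q, S)) (hV : V ⊆ summits m)
    (hS : S.head? = some Step.D) :
    (∃ i ≤ (glue (Q, S)).length,
      pos (glue (Q, S)) i = ((width (glue (Q, S)) : ℤ), (height (glue (Q, S)) : ℤ))) ↔
      Step.R ∉ S := by
  have hlen := length_glue (Q, S)
  dsimp only at hlen
  rw [h.width_glue, h.height_glue hV]
  constructor
  · rintro ⟨i, hi, hcorner⟩ hR
    have hR' := List.count_pos_iff.2 hR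
    rcases h.pos_glue hi with ⟨Q', hQ', -, hp⟩ | ⟨S', hS', -, hp⟩ <;>
      rw [hp, Prod.ext_iff] at hcorner
    · have hx := endp_fst_le_of_suffix h.no_left hQ'
      have hcounts := h.counts
      simp only [endp_eq] at hx hcorner hcounts
      omega
    · rw [h.right_snd hS', Nat.cast_inj] at hcorner
      obtain rfl := eq_of_suffix_of_count_eq hS hS' hcorner.2
      simp only [endp_eq, Prod.fst_neg] at hcorner
      omega
  · intro hR
    refine ⟨Q.length + 1, by omega, ?_⟩
    rw [pos_glue_right h.endp_glue List.suffix_rfl (by omega), Prod.ext_iff]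
    refine ⟨?_, h.right_snd List.suffix_rfl⟩
    simp [endp_eq, List.count_eq_zero.2 hR]

end Arcs

end Closed

/-! ### The arcs of a polygon -/

theorem pos_succ {w : List Step} {i : ℕ} (hi : i < w.length) :
    pos w (i + 1) = pos w i + w[i].vec := by
  rw [pos_eq_endp, pos_eq_endp, List.take_succ_eq_append_getElem hi, endp_append]
  simp [endp]

theorem exists_descent {f : ℕ → ℤ} {v : ℤ} {N n : ℕ} (hn : N ≤ n) (hN : v < f N) (hv : f n ≤ v) :
    ∃ e, N ≤ e ∧ e < n ∧ v < f e ∧ f (e + 1) ≤ v := by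
  induction n, hn using Nat.le_induction with
  | base => omega
  | succ n hn ih =>
    by_cases h : f n ≤ v
    · obtain ⟨e, hNe, hen, he⟩ := ih h
      exact ⟨e, hNe, by omega, he⟩
    · exact ⟨n, hn, by omega, by omega, hv⟩

theorem pos_snd_le_height {w : List Step} {i : ℕ} (hi : i ≤ w.length) : (pos w i).2 ≤ height w :=
  Int.toNat_le.1 <| Finset.le_sup (f := fun i => (pos w i).2.toNat) (Finset.mem_range_succ_iff.2 hi)

theorem pos_fst_le_width {w : List Step} {i : ℕ} (hi : i ≤ w.length) : (pos w i).1 ≤ width w :=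
  Int.toNat_le.1 <| Finset.le_sup (f := fun i => (pos w i).1.toNat) (Finset.mem_range_succ_iff.2 hi)

namespace IsRootedPolygon

variable {w : List Step} (H : IsRootedPolygon w)
include H

theorem pos_one : pos w 1 = (0, 1) := by
  obtain ⟨w, rfl⟩ := List.head?_eq_some_iff.1 H.start
  simp [pos, Step.vec]

theorem isChain : w.IsChain fun s t => s.vec + t.vec ≠ 0 := by
  refine List.isChain_iff_getElem.2 fun i hi hrev => ?_
  have hpos : pos w (i + 2) = pos w i := by
    rw [pos_succ hi, pos_succ (Nat.lt_of_succ_lt hi), add_assoc, hrev, add_zero]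
  rcases Nat.lt_or_eq_of_le hi with hlt | heq
  · exact H.simple i (i + 2) (by omega) hlt hpos.symm
  · have := H.four_le
    refine H.simple 0 i (by omega) (by omega) ?_
    rw [← hpos, show i + 2 = w.length from heq, H.closed]
    rfl

theorem exists_fst_eq_width : ∃ i ≤ w.length, (pos w i).1 = width w := by
  obtain ⟨i, hi, hwidth⟩ := Finset.exists_mem_eq_sup (Finset.range (w.length + 1)) (by simp)
    (fun i => (pos w i).1.toNat)
  rw [Finset.mem_range_succ_iff] at hi
  refine ⟨i, hi, ?_⟩
  rw [width, hwidth, Int.toNat_of_nonneg (H.nonneg i hi).1]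

theorem exists_snd_eq_height : ∃ i ≤ w.length, (pos w i).2 = height w := by
  obtain ⟨i, hi, hheight⟩ := Finset.exists_mem_eq_sup (Finset.range (w.length + 1)) (by simp)
    (fun i => (pos w i).2.toNat)
  rw [Finset.mem_range_succ_iff] at hi
  refine ⟨i, hi, ?_⟩
  rw [height, hheight, Int.toNat_of_nonneg (H.nonneg i hi).2]

theorem exists_leftArc_eq : ∃ N ≤ w.length, leftArc w = w.take N ∧ (pos w N).2 = height w ∧
    ∀ i ≤ w.length, (pos w i).2 = height w → i ≤ N := by
  obtain ⟨i, hi, htop⟩ := H.exists_snd_eq_height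
  have mem_top {i : ℕ} (hi : i ≤ w.length) (htop : (pos w i).2 = height w) :
      i ∈ (Finset.range (w.length + 1)).filter fun i => (pos w i).2 = (height w : ℤ) :=
    Finset.mem_filter.2 ⟨Finset.mem_range_succ_iff.2 hi, htop⟩
  obtain ⟨N, hN, hsup⟩ := Finset.exists_mem_eq_sup _ ⟨i, mem_top hi htop⟩ id
  rw [Finset.mem_filter, Finset.mem_range_succ_iff] at hN
  refine ⟨N, hN.1, by rw [leftArc, hsup, id], hN.2, fun i hi htop => ?_⟩
  exact (Finset.le_sup (f := id) (mem_top hi htop)).trans hsup.le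

theorem reverse_verts_leftArc_ne (v : List Step) : (verts (leftArc w)).reverse ≠ Step.D :: v := by
  intro hv
  obtain ⟨N, hN, hleft, htop, -⟩ := H.exists_leftArc_eq
  rw [List.reverse_eq_iff, List.reverse_cons, verts, List.filter_eq_append_iff] at hv
  obtain ⟨l₁, l₂, hsplit, -, hl₂⟩ := hv
  have hfall : (endp l₂).2 = -1 := by rw [← endp_verts_snd, verts, hl₂]; rfl
  have hprefix : l₁ <+: w :=
    (List.prefix_append l₁ l₂).trans (hsplit ▸ hleft ▸ List.take_prefix N w)
  have hle := pos_snd_le_height hprefix.length_le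
  rw [pos_eq_endp, ← List.prefix_iff_eq_take.1 hprefix] at hle
  rw [pos_eq_endp, ← hleft, hsplit, endp_append, Prod.snd_add] at htop
  omega

end IsRootedPolygon

/-- The vertex `N` of a rooted polygon is the last one at the top, and the boundary walk does not go
up after it. -/
structure Crest (w : List Step) (N : ℕ) : Prop where
  poly : IsRootedPolygon w
  le : N ≤ w.length
  down : Step.U ∉ w.drop N
  top : ∀ i ≤ w.length, (pos w i).2 ≤ (pos w N).2
  last : ∀ i ≤ w.length, (pos w i).2 = (pos w N).2 → i ≤ N

namespace Crest

variable {w : List Step} {N : ℕ} (H : Crest w N)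
include H

theorem getElem_ne {j : ℕ} (hN : N ≤ j) (hj : j < w.length) : w[j] ≠ Step.U := by
  intro hU
  refine H.down (List.mem_iff_getElem.2 ⟨j - N, by simp; omega, ?_⟩)
  simpa only [List.getElem_drop, Nat.add_sub_cancel' hN] using hU

theorem snd_pos : 0 < (pos w N).2 := by
  have := H.top 1 (by linarith [H.poly.four_le])
  rw [H.poly.pos_one] at this
  exact this

theorem lt_length : N < w.length := by
  refine H.le.lt_of_ne fun heq => ?_
  have := H.snd_pos
  rw [heq, H.poly.closed] at this
  exact lt_irrefl _ this

theorem succ_lt_of_down {e : ℕ} (he : e < w.length) (hD : w[e] = Step.D) : e + 1 < w.length := by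
  refine lt_of_le_of_ne he fun heq => ?_
  have := H.poly.four_le
  have hpos := pos_succ he
  rw [heq, H.poly.closed, hD] at hpos
  refine H.poly.simple 1 e (by omega) he ?_
  rw [H.poly.pos_one, ← sub_eq_iff_eq_add.2 hpos]
  rfl

theorem step_right {j : ℕ} (hN : N ≤ j) (hj : j < w.length) :
    ((pos w (j + 1)).2 = (pos w j).2 ∧ (pos w (j + 1)).1 ≤ (pos w j).1 + 1 ∧
      (pos w j).1 ≤ (pos w (j + 1)).1 + 1) ∨
    ((pos w (j + 1)).2 = (pos w j).2 - 1 ∧ (pos w (j + 1)).1 = (pos w j).1 ∧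
      j + 1 < w.length) := by
  have hU := H.getElem_ne hN hj
  have hD := H.succ_lt_of_down hj
  rw [pos_succ hj]
  cases hs : w[j] <;> simp_all [Step.vec] <;> omega

theorem exists_down {v : ℤ} (hv : 0 ≤ v) (hvN : v < (pos w N).2) :
    ∃ e, N ≤ e ∧ e + 1 < w.length ∧ (pos w e).2 = v + 1 ∧ (pos w (e + 1)).2 = v ∧
      (pos w (e + 1)).1 = (pos w e).1 := by
  obtain ⟨e, hNe, he, hlt, hle⟩ := exists_descent (f := fun i => (pos w i).2) H.le hvN
    (by rw [H.poly.closed]; exact hv)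
  rcases H.step_right hNe he with hstep | hstep
  · omega
  · exact ⟨e, hNe, hstep.2.2, by omega, by omega, hstep.2.1⟩

theorem antitone {j j' : ℕ} (hN : N ≤ j) (hj : j ≤ j') (hj' : j' < w.length) :
    (pos w j').2 ≤ (pos w j).2 := by
  induction j', hj using Nat.le_induction with
  | base => exact le_rfl
  | succ k hk ih =>
    have := ih (by omega)
    have := H.step_right (hN.trans hk) (by omega)
    omega

theorem lt_iff {i : ℕ} (hi : i < N) {j j' : ℕ} (hN : N ≤ j) (hj : j ≤ j')
    (hj' : j' < w.length) (hij : (pos w i).2 = (pos w j).2) (hij' : (pos w i).2 = (pos w j').2) :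
    (pos w i).1 < (pos w j).1 ↔ (pos w i).1 < (pos w j').1 := by
  induction j', hj using Nat.le_induction with
  | base => rfl
  | succ k hk ih =>
    have hkj := H.antitone hN hk (by omega)
    have hk' : (pos w (k + 1)).2 ≤ _ := H.antitone (hN.trans hk) (Nat.le_succ k) hj'
    rw [ih (by omega) (by omega)]
    have hstep := H.step_right (hN.trans hk) (by omega)
    have hne := H.poly.simple i k (by omega) (by omega)
    have hne' := H.poly.simple i (k + 1) (by omega) (by omega)
    rw [ne_eq, Prod.ext_iff] at hne hne'
    omega

theorem lt_of_lt {i : ℕ} (hi : i < N) {j j' : ℕ} (hN : N ≤ j) (hN' : N ≤ j')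
    (hj : j < w.length) (hj' : j' < w.length) (hij : (pos w i).2 = (pos w j).2)
    (hij' : (pos w i).2 = (pos w j').2) (h : (pos w i).1 < (pos w j).1) :
    (pos w i).1 < (pos w j').1 := by
  rcases le_total j j' with hjj | hjj
  · exact (H.lt_iff hi hN hjj hj' hij hij').1 h
  · exact (H.lt_iff hi hN' hjj hj hij' hij).2 h

theorem leftOf {i : ℕ} (hi : i < N) {j : ℕ} (hN : N ≤ j) (hj : j < w.length) :
    LeftOf (pos w i) (pos w j) := by
  intro hy
  induction i generalizing j with
  | zero =>
    have hne := H.poly.simple 0 j (by omega) hj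
    have hx := (H.poly.nonneg j hj.le).1
    rw [show pos w 0 = 0 from rfl, ne_eq, Prod.ext_iff] at hne
    rw [show pos w 0 = 0 from rfl] at hy ⊢
    simp only [Prod.fst_zero, Prod.snd_zero] at hne hy ⊢
    omega
  | succ i ih =>
    have hle := H.le
    have hpos := pos_succ (w := w) (i := i) (by omega)
    have hne := H.poly.simple (i + 1) j (by omega) hj
    rw [ne_eq, Prod.ext_iff] at hne
    have hy₀ := (H.poly.nonneg i (by omega)).2
    have hy₁ := (H.poly.nonneg (i + 1) (by omega)).2
    have htop := H.top i (by omega)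
    have htop' := H.top (i + 1) (by omega)
    cases hs : w[i] <;> rw [hs, Prod.ext_iff] at hpos <;>
      simp only [Step.vec, Prod.fst_add, Prod.snd_add] at hpos
    case U =>
      obtain ⟨e, hNe, he, hye, hye', hxe⟩ := H.exists_down (v := (pos w i).2) (by omega) (by omega)
      have := ih (by omega) (j := e + 1) (by omega) he (by omega)
      exact H.lt_of_lt hi hNe hN (by omega) hj (by omega) hy (by omega)
    case D =>
      obtain ⟨e, hNe, he, hye, hye', hxe⟩ :=
        H.exists_down (v := (pos w (i + 1)).2) (by omega) (by omega)
      have := ih (by omega) (j := e) (by omega) (by omega) (by omega)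
      exact H.lt_of_lt hi (j := e + 1) (by omega) hN (by omega) hj (by omega) hy (by omega)
    all_goals
      have := ih (by omega) hN hj (by omega)
      omega

theorem exists_right {i : ℕ} (hi : i ≤ w.length) :
    ∃ j, N ≤ j ∧ j < w.length ∧ (pos w j).2 = (pos w i).2 := by
  rcases (H.poly.nonneg i hi).2.lt_or_eq with hpos | hzero
  · obtain ⟨e, hNe, he, hy, -⟩ :=
      H.exists_down (v := (pos w i).2 - 1) (by omega) (by have := H.top i hi; omega)
    exact ⟨e, hNe, by omega, by omega⟩
  · obtain ⟨e, hNe, he, -, hy, -⟩ := H.exists_down le_rfl H.snd_pos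
    exact ⟨e + 1, by omega, he, by omega⟩

theorem left_notMem_take {i₀ : ℕ} (hi₀ : i₀ ≤ w.length) (hL : Step.L ∉ w.take i₀)
    (hmax : ∀ i ≤ w.length, (pos w i).1 ≤ (pos w i₀).1) : Step.L ∉ w.take N := by
  rcases le_or_gt N i₀ with hle | hlt
  · exact fun hm => hL (List.mem_of_mem_take (by rwa [List.take_take, min_eq_left hle]))
  · obtain ⟨j, hNj, hj, hy⟩ := H.exists_right hi₀
    exact absurd (H.leftOf hlt hNj hj hy.symm) (hmax j hj.le).not_gt

end Crest

theorem IsRootedPolygon.count_eq {w : List Step} (H : IsRootedPolygon w) :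
    w.count Step.R = w.count Step.L ∧ w.count Step.U = w.count Step.D := by
  have hclosed := H.closed
  rw [pos_eq_endp, List.take_length, endp_eq, Prod.mk_eq_zero] at hclosed
  omega

/-- The `m` down steps of the left arc use up the whole excess `2 * m` of the perimeter. -/
theorem IsUnimodal.steps {m : ℕ} {w : List Step} (hw : IsUnimodal m w) {N i₀ : ℕ}
    (hN : (pos w N).2 = height w) (hm : (w.take N).count Step.D = m)
    (hi₀ : (pos w i₀).1 = width w) :
    Step.U ∉ w.drop N ∧ Step.L ∉ w.take i₀ ∧ Step.R ∉ w.drop i₀ := by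
  obtain ⟨H, hlen⟩ := hw
  have hclosed := H.count_eq
  have hcount := length_eq_counts w
  have count_split (i : ℕ) (s : Step) : w.count s = (w.take i).count s + (w.drop i).count s := by
    rw [← List.count_append, List.take_append_drop]
  have hU := count_split N Step.U
  have hL := count_split i₀ Step.L
  have hR := count_split i₀ Step.R
  rw [pos_eq_endp, endp_eq] at hN hi₀
  dsimp only at hN hi₀
  simp only [← List.count_eq_zero]
  omega

namespace Crest

variable {w : List Step} {N : ℕ} (H : Crest w N)
include H

theorem head?_drop : (w.drop N).head? = some Step.D := by
  rw [List.head?_drop, List.getElem?_eq_getElem H.lt_length, Option.some_inj]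
  have hlast := H.last (N + 1) H.lt_length
  have hU := H.getElem_ne le_rfl H.lt_length
  have hpos := pos_succ H.lt_length
  rw [hpos] at hlast
  cases hs : w[N]'(H.lt_length) <;> simp_all [Step.vec]

theorem glue_take_drop (hL : Step.L ∉ w.take N) :
    glue ((w.take (N - 1)).reverse, w.drop N) = w := by
  obtain ⟨n, rfl⟩ : ∃ n, N = n + 1 := by
    refine Nat.exists_eq_succ_of_ne_zero ?_
    rintro rfl
    exact lt_irrefl _ H.snd_pos
  have hlt := H.lt_length
  have hn : n < w.length := by omega
  have htake : w.take (n + 1) = w.take n ++ [w[n]] := List.take_succ_eq_append_getElem hn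
  have hD : w[n + 1] = Step.D := by
    simpa only [List.head?_drop, List.getElem?_eq_getElem hlt, Option.some_inj] using H.head?_drop
  have hturn := List.isChain_iff_getElem.1 H.poly.isChain n hlt
  have htop := H.top n hn.le
  rw [pos_succ hn] at htop
  have hR : w[n] = Step.R := by
    cases hs : w[n]
    case U => simp [hs, hD, Step.vec] at hturn
    case R => rfl
    case D => simp [hs, Step.vec] at htop
    case L => simp [htake, hs] at hL
  rw [glue, List.reverse_reverse, Nat.add_sub_cancel, ← hR, ← List.singleton_append,
    ← List.append_assoc, ← htake, List.take_append_drop]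

theorem pos_length_sub_one : pos w (w.length - 1) = (1, 0) := by
  have hfour := H.poly.four_le
  have hlt : w.length - 1 < w.length := by omega
  have hpos := pos_succ hlt
  have hx := (H.poly.nonneg _ hlt.le).1
  have hU := H.getElem_ne (Nat.le_sub_one_of_lt H.lt_length) hlt
  have hD := H.succ_lt_of_down hlt
  rw [Nat.sub_add_cancel (by omega), H.poly.closed, eq_comm, add_eq_zero_iff_eq_neg] at hpos
  rw [hpos] at hx ⊢
  rw [Nat.sub_add_cancel (by omega)] at hD
  cases hs : w[w.length - 1] <;> simp_all [Step.vec]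

theorem head?_left_ne {Q S : List Step} (hglue : glue (Q, S) = w) (hQ : Q.length + 1 = N) :
    Q.head? ≠ some Step.D := by
  subst hglue hQ
  intro hD
  have hle := H.le
  have htop : pos (glue (Q, S)) (Q.length + 1) = endp Q + Step.R.vec := by
    rw [pos_eq_endp, glue, ← List.singleton_append, ← List.append_assoc, List.take_left' (by simp),
      endp_append, endp_reverse]
    simp [endp]
  obtain ⟨Q, rfl⟩ := List.head?_eq_some_iff.1 hD
  rw [List.length_cons] at hle
  have hhigh := H.top Q.length (by omega)
  rw [pos_glue_left S (List.suffix_cons Step.D Q), htop, endp_cons] at hhigh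
  simp [Step.vec] at hhigh

theorem disjoint_arcs {Q S : List Step} (hglue : glue (Q, S) = w) (hQ : Q.length + 1 = N)
    {Q' S' : List Step} (hQ' : Q' <:+ Q) (hS' : S' <:+ S) (hne : Q' ≠ [] ∨ S' ≠ []) :
    LeftOf (endp Q') (-endp S') := by
  subst hglue hQ
  have hlen := length_glue (Q, S)
  have hclosed := H.poly.closed
  rw [pos_eq_endp, List.take_length] at hclosed
  have hQ'N := Nat.lt_succ_of_le hQ'.length_le
  have hSlen := hS'.length_le
  dsimp only at hlen
  rw [← pos_glue_left S hQ']
  rcases eq_or_ne S' [] with rfl | hS'ne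
  · have hQ'pos := List.length_pos_iff.2 (hne.resolve_right (not_not.2 rfl))
    have hleft := H.leftOf hQ'N (Nat.le_sub_one_of_lt H.lt_length) (by omega)
    have hx := (H.poly.nonneg Q'.length (by omega)).1
    have horigin := H.poly.simple 0 Q'.length hQ'pos (by omega)
    rw [show pos (glue (Q, S)) 0 = 0 from rfl, ne_eq, Prod.ext_iff] at horigin
    rw [H.pos_length_sub_one] at hleft
    simp only [LeftOf, endp, List.map_nil, List.sum_nil, neg_zero, Prod.fst_zero,
      Prod.snd_zero] at hleft horigin ⊢
    omega
  · have hS'pos := List.length_pos_iff.2 hS'ne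
    rw [← pos_glue_right hclosed hS' (i := (glue (Q, S)).length - S'.length) (by omega)]
    exact H.leftOf hQ'N (by omega) (by omega)

theorem arcs {V : Set (List Step)} (hL : Step.L ∉ w.take N)
    (hord : w.Pairwise fun s t => s = Step.L → t ≠ Step.R)
    (hV : (verts (w.take N)).reverse ∈ V) {Q S : List Step} (hglue : glue (Q, S) = w)
    (hQ : Q.length + 1 = N) : Arcs V 1 0 (Q, S) := by
  have hdisj := fun Q' S' => H.disjoint_arcs hglue hQ (Q' := Q') (S' := S')
  subst hglue hQ
  have htake : (glue (Q, S)).take (Q.length + 1) = Q.reverse ++ [Step.R] := by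
    simp [glue, List.take_append]
  have hdrop : (glue (Q, S)).drop (Q.length + 1) = S := by
    simp [glue, List.drop_append]
  have hchain := H.poly.isChain
  have hclosed := H.poly.closed
  have hdown := H.down
  have hstart := H.poly.start
  rw [hdrop] at hdown
  rw [htake] at hL hV
  rw [pos_eq_endp, List.take_length, glue, endp_append, endp_cons, endp_reverse,
    Prod.ext_iff] at hclosed
  simp only [Prod.fst_add, Prod.snd_add, Step.vec, Prod.fst_zero, Prod.snd_zero] at hclosed
  rw [glue] at hchain hord hstart
  exact {
    no_left := fun hm => hL (by simp [hm])
    no_up := hdown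
    chain_left := by
      have := List.isChain_reverse.1 hchain.left_of_append
      simpa only [add_comm] using this
    chain_right := hchain.right_of_append.tail
    start := by
      intro s hs
      rw [List.head?_append, List.head?_reverse, Option.mem_def.1 hs] at hstart
      simpa using hstart
    ordered := (List.pairwise_append.1 hord).2.1.tail
    word := by
      simpa [verts_reverse, verts] using hV
    disjoint := hdisj
    gap := by dsimp only; omega
    excess := by dsimp only; omega }

end Crest

/-! ### Classes of polygons with a prescribed left arc -/

section Prescribed

variable {m : ℕ} {V : Set (List Step)}

theorem IsUnimodal.exists_arcs {w : List Step} (hw : IsUnimodal m w) (hV : V ⊆ summits m)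
    (hword : (verts (leftArc w)).reverse ∈ V) :
    ∃ c, Arcs V 1 0 c ∧ c.1.head? ≠ some Step.D ∧ c.2.head? = some Step.D ∧ glue c = w := by
  have H := hw.1
  obtain ⟨N, hN, harc, htop, hlast⟩ := H.exists_leftArc_eq
  obtain ⟨i₀, hi₀, hwidth⟩ := H.exists_fst_eq_width
  rw [harc] at hword
  have hdowns : (w.take N).count Step.D = m := by
    rw [← count_verts (.inr rfl), ← List.count_reverse]
    exact (hV hword).1
  obtain ⟨hU, hL, hR⟩ := hw.steps htop hdowns hwidth
  have crest : Crest w N :=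
    { poly := H
      le := hN
      down := hU
      top := fun i hi => htop ▸ pos_snd_le_height hi
      last := fun i hi heq => hlast i hi (heq.trans htop) }
  have hLN : Step.L ∉ w.take N :=
    crest.left_notMem_take hi₀ hL fun i hi => hwidth ▸ pos_fst_le_width hi
  have hord : w.Pairwise fun s t => s = Step.L → t ≠ Step.R := by
    rw [← List.take_append_drop i₀ w, List.pairwise_append]
    exact ⟨List.pairwise_of_forall_mem_list fun s hs t _ hsL => (hL (hsL ▸ hs)).elim,
      List.pairwise_of_forall_mem_list fun s _ t ht _ htR => hR (htR ▸ ht),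
      fun s hs t _ hsL => (hL (hsL ▸ hs)).elim⟩
  have hglue := crest.glue_take_drop hLN
  have hlen : (w.take (N - 1)).reverse.length + 1 = N := by
    have hpos : N ≠ 0 := by rintro rfl; exact lt_irrefl _ crest.snd_pos
    rw [List.length_reverse, List.length_take]
    omega
  exact ⟨_, crest.arcs hLN hord hword hglue hlen, crest.head?_left_ne hglue hlen,
    crest.head?_drop, hglue⟩

theorem verts_leftArc_glue {c : Cfg} (h : Arcs V 1 0 c) (hV : V ⊆ summits m)
    (hS : c.2.head? = some Step.D) : (verts (leftArc (glue c))).reverse = verts c.1 := by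
  rw [h.leftArc_glue hV hS, ← verts_reverse]
  simp [verts]

variable {p : List Step → Prop}

theorem setOf_isStaircase_eq_image_glue (hV : V ⊆ summits m)
    (hp : ∀ w, IsRootedPolygon w → (p w ↔ (verts (leftArc w)).reverse ∈ V)) :
    {w | IsStaircase m w ∧ p w} = glue '' ready V .inc 1 := by
  ext w
  constructor
  · rintro ⟨⟨hw, hcorner⟩, hpw⟩
    obtain ⟨c, h, hQ, hS, rfl⟩ := hw.exists_arcs hV ((hp w hw.1).1 hpw)
    have hR := (h.exists_pos_glue_eq_corner_iff hV hS).1 hcorner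
    exact ⟨c, ⟨h, stage_eq_inc.2 hR, hQ, hS⟩, rfl⟩
  · rintro ⟨c, ⟨h, hσ, -, hS⟩, rfl⟩
    refine ⟨⟨h.isUnimodal_glue hV hS, ?_⟩, (hp _ (h.isRootedPolygon_glue hS)).2 ?_⟩
    · exact (h.exists_pos_glue_eq_corner_iff hV hS).2 (stage_eq_inc.1 hσ)
    · exact verts_leftArc_glue h hV hS ▸ h.word

theorem setOf_isUnimodal_eq_image_glue (hV : V ⊆ summits m)
    (hp : ∀ w, IsRootedPolygon w → (p w ↔ (verts (leftArc w)).reverse ∈ V)) :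
    {w | IsUnimodal m w ∧ p w} = glue '' (ready V .inc 1 ∪ ready V .dec 1) := by
  ext w
  constructor
  · rintro ⟨hw, hpw⟩
    obtain ⟨c, h, hQ, hS, rfl⟩ := hw.exists_arcs hV ((hp w hw.1).1 hpw)
    cases hσ : stage c.2
    · exact ⟨c, .inl ⟨h, hσ, hQ, hS⟩, rfl⟩
    · exact ⟨c, .inr ⟨h, hσ, hQ, hS⟩, rfl⟩
  · rintro ⟨c, ⟨h, -, -, hS⟩ | ⟨h, -, -, hS⟩, rfl⟩ <;>
      exact ⟨h.isUnimodal_glue hV hS,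
        (hp _ (h.isRootedPolygon_glue hS)).2 (verts_leftArc_glue h hV hS ▸ h.word)⟩

theorem genFun_image_glue (hV : V ⊆ summits m) {s : Set Cfg}
    (hs : ∀ c ∈ s, Arcs V 1 0 c ∧ c.2.head? = some Step.D) : genFun (glue '' s) = gfs s := by
  have hsteps_glue : ∀ c ∈ s, hsteps (glue c) = 2 * c.2.count Step.L ∧
      vsteps (glue c) = 2 * c.1.count Step.U := by
    intro c hc
    have hcounts := (hs c hc).1.counts
    simp only [hsteps, vsteps, glue, List.count_append, List.count_reverse, List.count_cons]
    simp only [beq_iff_eq, reduceCtorEq, if_true, if_false]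
    omega
  have hinj : Set.InjOn glue s := by
    intro c hc c' hc' heq
    have harc := congrArg leftArc heq
    rw [(hs c hc).1.leftArc_glue hV (hs c hc).2, (hs c' hc').1.leftArc_glue hV (hs c' hc').2,
      List.append_left_inj, List.reverse_inj] at harc
    rw [glue, glue, harc, List.append_right_inj, List.cons_inj_right] at heq
    exact Prod.ext harc heq
  ext n
  rw [coeff_gfs]
  change (({w ∈ glue '' s | hsteps w = 2 * n 0 ∧ vsteps w = 2 * n 1}.ncard : ℕ) : ℚ) = _
  rw [← (hinj.mono (Set.sep_subset s _)).ncard_image]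
  congr 2
  ext w
  constructor
  · rintro ⟨⟨c, hc, rfl⟩, hn⟩
    rw [(hsteps_glue c hc).1, (hsteps_glue c hc).2] at hn
    exact ⟨c, ⟨hc, (wt_eq_iff c n).2 (by omega)⟩, rfl⟩
  · rintro ⟨c, ⟨hc, hn⟩, rfl⟩
    rw [wt_eq_iff] at hn
    refine ⟨⟨c, hc, rfl⟩, ?_⟩
    rw [(hsteps_glue c hc).1, (hsteps_glue c hc).2]
    omega

theorem genFun_isStaircase (hV : V ⊆ summits m)
    (hp : ∀ w, IsRootedPolygon w → (p w ↔ (verts (leftArc w)).reverse ∈ V)) :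
    genFun {w | IsStaircase m w ∧ p w} = gfs (ready V .inc 1) := by
  rw [setOf_isStaircase_eq_image_glue hV hp,
    genFun_image_glue hV fun c hc => ⟨hc.1, hc.2.2.2⟩]

theorem genFun_isUnimodal (hV : V ⊆ summits m)
    (hp : ∀ w, IsRootedPolygon w → (p w ↔ (verts (leftArc w)).reverse ∈ V)) :
    genFun {w | IsUnimodal m w ∧ p w} = gfs (ready V .inc 1) + gfs (ready V .dec 1) := by
  have hdisj : Disjoint (ready V .inc 1) (ready V .dec 1) :=
    Set.disjoint_left.2 fun c ⟨_, hinc, _⟩ ⟨_, hdec, _⟩ => by simp [hinc] at hdec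
  rw [setOf_isUnimodal_eq_image_glue hV hp, genFun_image_glue hV,
    gfs_of_eq_union rfl hdisj]
  · rintro c (hc | hc) <;> exact ⟨V, 1, 0, hc.1⟩
  · rintro c (hc | hc) <;> exact ⟨hc.1, hc.2.2.2⟩

end Prescribed

/-! ### Two indents -/

theorem cons_up_mem_summits {m : ℕ} {v : List Step} (hv : v ∈ summits m) :
    Step.U :: v ∈ summits m := by
  refine ⟨by simpa using hv.1, fun v' hv' => ?_⟩
  rcases List.suffix_cons_iff.1 hv' with rfl | hv'
  · rfl
  · have := hv.2 v' hv'
    simp only [endp_cons, Step.vec, Prod.snd_add]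
    omega

theorem up_down_up_mem_summits {m : ℕ} {v : List Step} (hv : Step.U :: v ∈ summits m) :
    Step.U :: Step.D :: Step.U :: v ∈ summits (m + 1) := by
  refine ⟨by simpa using hv.1, fun v' hv' => ?_⟩
  rcases List.suffix_cons_iff.1 hv' with rfl | hv'
  · rfl
  rcases List.suffix_cons_iff.1 hv' with rfl | hv'
  · simp [endp_cons, Step.vec]
  · have := hv.2 v' hv'
    simpa [endp_cons, Step.vec] using this

theorem image_cons_above_subset_summits {m : ℕ} {W : Set (List Step)}
    (hW : List.cons Step.U '' W ⊆ summits m) : List.cons Step.U '' above W ⊆ summits m := by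
  rintro _ ⟨_, ⟨c, v, hv, rfl⟩, rfl⟩
  induction c with
  | zero => exact hW ⟨v, hv, rfl⟩
  | succ c ih => exact cons_up_mem_summits ih

theorem image_cons_indentOn_subset_summits {m : ℕ} {T : Set (List Step)}
    (hT : List.cons Step.U '' T ⊆ summits m) :
    List.cons Step.U '' indentOn T ⊆ summits (m + 1) := by
  rintro _ ⟨_, ⟨_, ⟨v, hv, rfl⟩, rfl⟩, rfl⟩
  exact up_down_up_mem_summits (hT ⟨v, hv, rfl⟩)

theorem image_cons_unindented_subset_summits : List.cons Step.U '' unindented ⊆ summits 0 := by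
  refine image_cons_above_subset_summits ?_
  rw [Set.image_singleton, Set.singleton_subset_iff]
  exact cons_up_mem_summits ⟨rfl, fun v' hv' => by rw [List.suffix_nil.1 hv']⟩

theorem farIndents_subset_summits : farIndents ⊆ summits 2 := by
  refine image_cons_above_subset_summits (image_cons_indentOn_subset_summits ?_)
  rintro _ ⟨v, hv, rfl⟩
  exact cons_up_mem_summits (image_cons_above_subset_summits
    (image_cons_indentOn_subset_summits image_cons_unindented_subset_summits) hv)

theorem nearIndents_subset_summits : nearIndents ⊆ summits 2 :=
  image_cons_above_subset_summits (image_cons_indentOn_subset_summits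
    (image_cons_indentOn_subset_summits image_cons_unindented_subset_summits))

theorem mem_farIndents {v : List Step} : v ∈ farIndents ↔ ∃ a b c,
    v = List.replicate (c + 1) Step.U ++ Step.D :: (List.replicate (b + 2) Step.U ++
      Step.D :: List.replicate (a + 1) Step.U) := by
  constructor
  · rintro ⟨_, ⟨c, _, ⟨_, ⟨_, ⟨_, ⟨b, _, ⟨_, ⟨_, ⟨a, _, rfl, rfl⟩, rfl⟩, rfl⟩, rfl⟩, rfl⟩, rfl⟩,
      rfl⟩, rfl⟩, rfl⟩
    exact ⟨a, b, c, by simp [List.replicate_succ]⟩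
  · rintro ⟨a, b, c, rfl⟩
    exact ⟨_, ⟨c, _, ⟨_, ⟨_, ⟨_, ⟨b, _, ⟨_, ⟨_, ⟨a, _, rfl, rfl⟩, rfl⟩, rfl⟩, rfl⟩, rfl⟩, rfl⟩,
      rfl⟩, rfl⟩, by simp [List.replicate_succ]⟩

theorem mem_nearIndents {v : List Step} : v ∈ nearIndents ↔ ∃ a c,
    v = List.replicate (c + 1) Step.U ++ Step.D :: ([Step.U] ++
      Step.D :: List.replicate (a + 1) Step.U) := by
  constructor
  · rintro ⟨_, ⟨c, _, ⟨_, ⟨_, ⟨_, ⟨_, ⟨a, _, rfl, rfl⟩, rfl⟩, rfl⟩, rfl⟩, rfl⟩, rfl⟩, rfl⟩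
    exact ⟨a, c, by simp [List.replicate_succ]⟩
  · rintro ⟨a, c, rfl⟩
    exact ⟨_, ⟨c, _, ⟨_, ⟨_, ⟨_, ⟨_, ⟨a, _, rfl, rfl⟩, rfl⟩, rfl⟩, rfl⟩, rfl⟩, rfl⟩,
      by simp [List.replicate_succ]⟩

theorem disjoint_farIndents_nearIndents : Disjoint farIndents nearIndents := by
  have dropWhile_up (n : ℕ) (v : List Step) :
      (List.replicate n Step.U ++ Step.D :: v).dropWhile (· = Step.U) = Step.D :: v := by
    simp
  rw [Set.disjoint_left]
  intro v hfar hnear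
  obtain ⟨a, b, c, rfl⟩ := mem_farIndents.1 hfar
  obtain ⟨a', c', heq⟩ := mem_nearIndents.1 hnear
  have := congrArg (List.dropWhile (· = Step.U)) heq
  rw [dropWhile_up, dropWhile_up] at this
  simp [List.replicate_succ] at this

theorem IsRootedPolygon.twoVerticalIndents_iff {w : List Step} (H : IsRootedPolygon w)
    {k₁ k₂ : ℕ} : TwoVerticalIndents w k₁ k₂ ↔ ∃ b c, 1 ≤ b ∧ k₂ + 1 = k₁ + b ∧
      (verts (leftArc w)).reverse = List.replicate (c + 1) Step.U ++ Step.D ::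
        (List.replicate b Step.U ++ Step.D :: List.replicate (k₁ + 1) Step.U) := by
  constructor
  · rintro ⟨_, b, c, hb, hw, rfl, hk⟩
    have hv : (verts (leftArc w)).reverse = List.replicate c Step.U ++ Step.D ::
        (List.replicate b Step.U ++ Step.D :: List.replicate (k₁ + 1) Step.U) :=
      (congrArg List.reverse hw).trans (by simp)
    obtain ⟨c, rfl⟩ : ∃ n, c = n + 1 := by
      refine Nat.exists_eq_succ_of_ne_zero ?_
      rintro rfl
      exact H.reverse_verts_leftArc_ne _ hv
    exact ⟨b, c, hb, by omega, hv⟩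
  · rintro ⟨b, c, hb, hk, hv⟩
    refine ⟨_, b, c + 1, hb, ?_, rfl, by omega⟩
    have hw := congrArg List.reverse hv
    rw [List.reverse_reverse] at hw
    exact hw.trans (by simp)

theorem IsRootedPolygon.exists_twoVerticalIndents_ne_iff {w : List Step} (H : IsRootedPolygon w) :
    (∃ k₁ k₂, TwoVerticalIndents w k₁ k₂ ∧ k₁ ≠ k₂) ↔
      (verts (leftArc w)).reverse ∈ farIndents := by
  simp only [H.twoVerticalIndents_iff, mem_farIndents]
  constructor
  · rintro ⟨k₁, k₂, ⟨b, c, hb, hk, hv⟩, hne⟩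
    obtain ⟨b, rfl⟩ := Nat.exists_eq_add_of_le' (show 2 ≤ b by omega)
    exact ⟨k₁, b, c, hv⟩
  · rintro ⟨a, b, c, hv⟩
    exact ⟨a, a + b + 1, ⟨b + 2, c, by omega, by omega, hv⟩, by omega⟩

theorem IsRootedPolygon.exists_twoVerticalIndents_iff {w : List Step} (H : IsRootedPolygon w) :
    (∃ k₁ k₂, TwoVerticalIndents w k₁ k₂) ↔
      (verts (leftArc w)).reverse ∈ farIndents ∪ nearIndents := by
  rw [Set.mem_union, ← H.exists_twoVerticalIndents_ne_iff, mem_nearIndents]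
  constructor
  · rintro ⟨k₁, k₂, h⟩
    rcases eq_or_ne k₁ k₂ with rfl | hne
    · obtain ⟨b, c, -, hk, hv⟩ := H.twoVerticalIndents_iff.1 h
      obtain rfl : b = 1 := by omega
      exact .inr ⟨k₁, c, hv⟩
    · exact .inl ⟨k₁, k₂, h, hne⟩
  · rintro (⟨k₁, k₂, h, -⟩ | ⟨a, c, hv⟩)
    · exact ⟨k₁, k₂, h⟩
    · exact ⟨a, a, H.twoVerticalIndents_iff.2 ⟨1, c, le_rfl, rfl, hv⟩⟩

theorem half_smul_y_pow_five (f : MvPowerSeries (Fin 2) ℚ) :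
    (1 / 2 : ℚ) • (y ^ 5 * dy (I ^ 2 * dy f)) = y ^ 5 * twice f := by
  rw [twice, mul_smul_comm]

theorem half_smul_y_pow_three (f : MvPowerSeries (Fin 2) ℚ) :
    (1 / 2 : ℚ) • (y ^ 3 * dy ((y * I) ^ 2 * dy f)) =
      y ^ 5 * twice f + y ^ 4 * (I ^ 2 * dy f) := by
  have hdy : y ^ 3 * dy ((y * I) ^ 2 * dy f) =
      y ^ 5 * dy (I ^ 2 * dy f) + (y ^ 4 * (I ^ 2 * dy f) + y ^ 4 * (I ^ 2 * dy f)) := by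
    rw [show (y * I) ^ 2 * dy f = y * (y * (I ^ 2 * dy f)) by ring, dy_y_mul, dy_y_mul]
    ring
  rw [hdy, smul_add, smul_add, half_smul_add_half_smul, half_smul_y_pow_five]

end AlmostConvex

end

open AlmostConvex in
theorem proposition2 :
    (genFun {w | IsStaircase 2 w ∧ ∃ k₁ k₂, TwoVerticalIndents w k₁ k₂ ∧ k₁ ≠ k₂} =
      (1 / 2 : ℚ) • (y ^ 5 * dy (I ^ 2 * dy (divY SP)))) ∧
    (genFun {w | IsUnimodal 2 w ∧ ∃ k₁ k₂, TwoVerticalIndents w k₁ k₂ ∧ k₁ ≠ k₂} =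
      (1 / 2 : ℚ) • (y ^ 5 * dy (I ^ 2 * dy (x * Z)))) ∧
    (genFun {w | IsStaircase 2 w ∧ ∃ k₁ k₂, TwoVerticalIndents w k₁ k₂} =
      (1 / 2 : ℚ) • (y ^ 3 * dy ((y * I) ^ 2 * dy (divY SP)))) ∧
    (genFun {w | IsUnimodal 2 w ∧ ∃ k₁ k₂, TwoVerticalIndents w k₁ k₂} =
      (1 / 2 : ℚ) • (y ^ 3 * dy ((y * I) ^ 2 * dy (x * Z)))) := by
  have far := farIndents_subset_summits
  have both := Set.union_subset far nearIndents_subset_summits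
  have ne_iff := fun w => IsRootedPolygon.exists_twoVerticalIndents_ne_iff (w := w)
  have iff := fun w => IsRootedPolygon.exists_twoVerticalIndents_iff (w := w)
  refine ⟨?_, ?_, ?_, ?_⟩
  · rw [genFun_isStaircase far ne_iff, gfs_ready_farIndents, expo_inc_one, half_smul_y_pow_five]
  · rw [genFun_isUnimodal far ne_iff, gfs_ready_farIndents, gfs_ready_farIndents, ← mul_add,
      ← twice_add, expo_inc_one_add_expo_dec_one, half_smul_y_pow_five]
  · rw [genFun_isStaircase both iff, gfs_ready_union disjoint_farIndents_nearIndents,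
      gfs_ready_farIndents, gfs_ready_nearIndents, expo_inc_one, half_smul_y_pow_three]
  · simp only [genFun_isUnimodal both iff, gfs_ready_union disjoint_farIndents_nearIndents,
      gfs_ready_farIndents, gfs_ready_nearIndents]
    rw [half_smul_y_pow_three, ← expo_inc_one_add_expo_dec_one, twice_add, dy_add]
    ring
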